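/- Let $N\ge 1$, $\nu\ge 0$, $M_r\ge 1$ be fixed integers (not growing with $SNR$). Consider the quasi-static SIMO ISI channel with $M_r$ receive antennas and $\nu+1$ taps, \[ \mathbf y[n]=\mathbf h_0x[n]+\mathbf h_1x[n-1]+\dots+\mathbf h_\nu x[n-\nu]+\mathbf z[n],\qquad 0\le n<N+\nu, \] with $x[n]=0$ for $n<0$, where $\mathbf h_0,\dots,\mathbf h_\nu$ and the noise vectors $\mathbf z[n]$ are independent $\mathcal{CN}(\mathbf 0,\mathbf I_{M_r})$ vectors, the taps stay fixed over the block of length $N+\nu$ and are known to the receiver only. At each $SNR$, a coding scheme encodes a uniformly distributed pair of independent messages from two sets of sizes $M_H,M_L\ge 2$ (depending on $SNR$) into a block $x[0],\dots,x[N+\nu-1]$ of average power at most $SNR$ per symbol, and decodes both messages from the taps and the received block. Let $R_H=\frac{\log M_H}{N+\nu}$, $R_L=\frac{\log M_L}{N+\nu}$, and let $P_e^H$, $P_e^L$ be the average error probabilities of the two messages. A tuple $(r_H,d_H,r_L,d_L)$ with $d_H\ge d_L$ is called achievable if some family of such schemes, indexed by $SNR$, satisfies, as $SNR\to\infty$,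 \[ \frac{R_H}{\log SNR}\to r_H,\quad \frac{R_L}{\log SNR}\to r_L,\quad -\frac{\log P_e^H}{\log SNR}\to d_H,\quad -\frac{\log P_e^L}{\log SNR}\to d_L . \] Then the diversity multiplexing tradeoff is successively refinable in the following sense. Let $r_H,r_L\ge 0$ with $r_H+r_L\le \frac{N}{N+\nu}$. (i) There is an achievable tuple $(r_H,d_H,r_L,d_L)$ for which, simultaneously, \[ M_r(\nu+1)\Bigl(1-\tfrac{N+\nu}{N}r_H\Bigr)\le d_H ,\qquad M_r(\nu+1)\Bigl(1-\tfrac{N+\nu}{N}(r_H+r_L)\Bigr)\le d_L . \] (ii) Every achievable tuple $(r_H,d_H,r_L,d_L)$ satisfies \[ d_H\le M_r(\nu+1)(1-r_H),\qquad d_L\le M_r(\nu+1)\bigl(1-(r_H+r_L)\bigr). \] -/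

import Mathlib

open MeasureTheory ProbabilityTheory Filter
open scoped NNReal

namespace SimoIsi

/-- The law `CN(0,1)`: real and imaginary parts are independent, each `N(0, 1/2)`. -/
noncomputable def stdComplexGaussian : Measure ℂ :=
  ((gaussianReal 0 (1 / 2)).prod (gaussianReal 0 (1 / 2))).map
    Complex.measurableEquivRealProd.symm

/-- The `ν + 1` channel taps; `h m p` is the `m`-th tap towards receive antenna `p`. -/
abbrev Taps (ν Mr : ℕ) : Type := Fin (ν + 1) → Fin Mr → ℂ

/-- An array of received (or noise) samples over one block of length `N + ν`:
`y n p` is the sample at time `n` on receive antenna `p`. -/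
abbrev Samples (N ν Mr : ℕ) : Type := Fin (N + ν) → Fin Mr → ℂ

/-- The joint law of taps and noise: all entries are i.i.d. `CN(0,1)`. -/
noncomputable def channelLaw (N ν Mr : ℕ) : Measure (Taps ν Mr × Samples N ν Mr) :=
  (Measure.pi fun _ => Measure.pi fun _ => stdComplexGaussian).prod
    (Measure.pi fun _ => Measure.pi fun _ => stdComplexGaussian)

/-- The received block `y[n] = h₀ x[n] + h₁ x[n-1] + ⋯ + h_ν x[n-ν] + z[n]`, `0 ≤ n < N + ν`,
where nothing is transmitted before the block (`x[n] = 0` for `n < 0`). The taps do not change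
during the block. -/
def received {N ν Mr : ℕ} (h : Taps ν Mr) (x : Fin (N + ν) → ℂ) (z : Samples N ν Mr) :
    Samples N ν Mr := fun n p =>
  (∑ m : Fin (ν + 1),
    h m p * (if (m : ℕ) ≤ n then x ⟨n - m, lt_of_le_of_lt (Nat.sub_le _ _) n.isLt⟩ else 0))
  + z n p

/-- A coding scheme for two message streams over one block of length `N + ν` at signal-to-noise
ratio `snr` (the noise has unit variance, so that `snr` is the transmit power). Each stream has at
least two messages. The decoder knows the channel taps and the received block. -/
structure TwoStreamCode (N ν Mr : ℕ) (snr : ℝ≥0) where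
  /-- number of messages of the high priority stream -/
  numH : ℕ
  /-- number of messages of the low priority stream -/
  numL : ℕ
  two_le_numH : 2 ≤ numH
  two_le_numL : 2 ≤ numL
  /-- the transmitted block for a pair of messages -/
  enc : Fin numH → Fin numL → Fin (N + ν) → ℂ
  /-- average transmit power over the block and over all message pairs -/
  power_le : (∑ i, ∑ j, ∑ n, ‖enc i j n‖ ^ 2) / ((numH : ℝ) * numL * ((N : ℝ) + ν)) ≤ snr
  /-- decoder of the high priority message -/
  decH : Taps ν Mr → Samples N ν Mr → Fin numH
  /-- decoder of the low priority message -/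
  decL : Taps ν Mr → Samples N ν Mr → Fin numL
  measurable_decH : Measurable fun q : Taps ν Mr × Samples N ν Mr => decH q.1 q.2
  measurable_decL : Measurable fun q : Taps ν Mr × Samples N ν Mr => decL q.1 q.2

namespace TwoStreamCode

variable {N ν Mr : ℕ} {snr : ℝ≥0} (C : TwoStreamCode N ν Mr snr)

/-- Rate of the high priority stream, in nats per channel use. -/
noncomputable def rateH : ℝ := Real.log C.numH / ((N : ℝ) + ν)

/-- Rate of the low priority stream, in nats per channel use. -/
noncomputable def rateL : ℝ := Real.log C.numL / ((N : ℝ) + ν)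

/-- Error probability of the high priority stream: averaged over uniform message pairs, the
channel taps and the noise. -/
noncomputable def errH : ℝ :=
  (∑ i, ∑ j, (channelLaw N ν Mr).real {q | C.decH q.1 (received q.1 (C.enc i j) q.2) ≠ i})
    / ((C.numH : ℝ) * C.numL)

/-- Error probability of the low priority stream: averaged over uniform message pairs, the
channel taps and the noise. -/
noncomputable def errL : ℝ :=
  (∑ i, ∑ j, (channelLaw N ν Mr).real {q | C.decL q.1 (received q.1 (C.enc i j) q.2) ≠ j})
    / ((C.numH : ℝ) * C.numL)

end TwoStreamCode

/-- The tuple `(rH, dH, rL, dL)` of multiplexing rates and diversity orders, `dH ≥ dL`, is achieved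
by a family of two-stream coding schemes indexed by `snr`, with fixed block length `N + ν`. -/
def Achievable (N ν Mr : ℕ) (rH dH rL dL : ℝ) : Prop :=
  dL ≤ dH ∧ ∃ C : (snr : ℝ≥0) → TwoStreamCode N ν Mr snr,
    Tendsto (fun snr : ℝ≥0 => (C snr).rateH / Real.log snr) atTop (nhds rH) ∧
    Tendsto (fun snr : ℝ≥0 => (C snr).rateL / Real.log snr) atTop (nhds rL) ∧
    Tendsto (fun snr : ℝ≥0 => -Real.log (C snr).errH / Real.log snr) atTop (nhds dH) ∧
    Tendsto (fun snr : ℝ≥0 => -Real.log (C snr).errL / Real.log snr) atTop (nhds dL)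

end SimoIsi

/-! All exponents come from one event: every tap is small. In the sup norm, `‖h‖ ≤ t` has
probability of order `t ^ (2 * Mr * (ν + 1))`, so with `t² = snr ^ (-e)` it costs the exponent `Mr
(ν + 1) e`.

Converse. Suppose `‖h‖ ≤ t` with `e > 1 - r`. Noiseless outputs of codewords of amplitude `O(√snr)`
then fall into about `snr ^ ((N + ν)(1 - e))` balls of fixed small radius (a single ball if `e >
1`), eventually at most half the number of messages. Gaussian laws centred in one such ball are
dominated by a common measure of mass at most `6/5`. Since decision regions are disjoint, the
correct decoding probabilities sum to at most `6/5` per ball. At most a tenth of the codewords have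
excessive energy, so the conditional error is at least `1 - 1/10 - 6/10`. This direct packing
argument (`outage_le_sum_err`, `exists_eventually_le_err`) also covers rate zero, where the number
of messages need not grow. The high stream is treated for each low message separately. For `dL` the
pair is treated as one message: its error is at most `errH + errL`, whose exponent is governed by
`dL` because `dL ≤ dH`.

Achievability. Codewords are points of a coarse grid refined by a fine one, followed by `ν` zeros.
The zeros make convolution injective, and compactness upgrades this to `‖h * x‖ ≥ c ‖h‖ ‖x‖`
(`exists_mul_norm_le_norm_received`). A confusion at distance `Δ` therefore needs either large noise
or `‖h‖` of order at most `τ / Δ`. The distance between different coarse points is `√snr / (4 mH)`,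
independent of the fine grid, so the high stream keeps the exponent it would have alone; this is the
successive refinability. With `τ = log snr` the noise term is superpolynomially small and the
remaining losses are logarithmic. Achievability asks for exact limits, so each decoder also fails
deliberately on a weak-tap event of probability of order `snr ^ (-d)` (`exists_gridCode`). -/

namespace SimoIsi

/-! ### One-dimensional Gaussian estimates -/

theorem gaussianReal_half_Icc_le (s : ℝ) :
    gaussianReal 0 (1 / 2) (Set.Icc (-s) s) ≤ ENNReal.ofReal (2 * s) := by
  rw [gaussianReal_apply _ (by norm_num)]
  calc ∫⁻ x in Set.Icc (-s) s, gaussianPDF 0 (1 / 2) x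
      ≤ ∫⁻ _ in Set.Icc (-s) s, 1 := by
        refine lintegral_mono fun x => ?_
        rw [gaussianPDF, gaussianPDFReal, ← ENNReal.ofReal_one]
        refine ENNReal.ofReal_le_ofReal ?_
        refine mul_le_one₀ ?_ (Real.exp_nonneg _) ?_
        · refine inv_le_one_of_one_le₀ (Real.one_le_sqrt.2 ?_)
          have := Real.pi_gt_three
          push_cast
          linarith
        · refine Real.exp_le_one_iff.2 ?_
          exact div_nonpos_of_nonpos_of_nonneg (neg_nonpos.2 (sq_nonneg _)) (by positivity)
    _ = ENNReal.ofReal (2 * s) := by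
        rw [setLIntegral_const, one_mul, Real.volume_Icc]
        congr 1; ring

theorem exists_le_gaussianReal_half_Icc : ∃ c : ℝ, 0 < c ∧ ∀ s : ℝ, s ≤ 1 →
    ENNReal.ofReal (c * s) ≤ gaussianReal 0 (1 / 2) (Set.Icc (-s) s) := by
  refine ⟨2 * gaussianPDFReal 0 (1 / 2) 1,
    mul_pos two_pos (gaussianPDFReal_pos _ _ _ (by norm_num)), fun s hs => ?_⟩
  rw [gaussianReal_apply _ (by norm_num)]
  calc ENNReal.ofReal (2 * gaussianPDFReal 0 (1 / 2) 1 * s)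
      = ∫⁻ _ in Set.Icc (-s) s, gaussianPDF 0 (1 / 2) 1 := by
        rw [setLIntegral_const, Real.volume_Icc, gaussianPDF,
          ← ENNReal.ofReal_mul (gaussianPDFReal_nonneg _ _ _)]
        congr 1; ring
    _ ≤ ∫⁻ x in Set.Icc (-s) s, gaussianPDF 0 (1 / 2) x := by
        refine setLIntegral_mono (measurable_gaussianPDF _ _) fun x hx => ?_
        refine ENNReal.ofReal_le_ofReal ?_
        unfold gaussianPDFReal
        refine mul_le_mul_of_nonneg_left (Real.exp_le_exp.2 ?_) (by positivity)
        have h1 : x ^ 2 ≤ 1 := (sq_le_one_iff_abs_le_one x).2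
          ((abs_le.2 ⟨hx.1, hx.2⟩).trans hs)
        have : (0 : ℝ) ≤ 2 * ((1 / 2 : ℝ≥0) : ℝ) := by positivity
        refine div_le_div_of_nonneg_right ?_ this
        simp only [sub_zero]
        linarith

theorem gaussianReal_half_Ici_le {τ : ℝ} (hτ : 0 ≤ τ) :
    gaussianReal 0 (1 / 2) {x | τ ≤ x} ≤ ENNReal.ofReal (Real.exp (-τ ^ 2)) := by
  -- The Chernoff exponent `-tτ + t²/4` is smallest at `t = 2τ`.
  have h := measure_ge_le_exp_mul_mgf (μ := gaussianReal 0 (1 / 2)) (X := id) (t := 2 * τ) τ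
    (by positivity) (integrable_exp_mul_gaussianReal _)
  rw [mgf_id_gaussianReal, ← Real.exp_add] at h
  rw [← ENNReal.ofReal_toReal (measure_ne_top _ _)]
  refine ENNReal.ofReal_le_ofReal (h.trans (Real.exp_le_exp.2 ?_))
  push_cast
  linarith [sq_nonneg τ]

theorem gaussianReal_half_abs_ge_le {τ : ℝ} (hτ : 0 ≤ τ) :
    gaussianReal 0 (1 / 2) {x | τ ≤ |x|} ≤ ENNReal.ofReal (2 * Real.exp (-τ ^ 2)) := by
  have hsub : {x : ℝ | τ ≤ |x|} = {x | τ ≤ x} ∪ (fun x => -x) ⁻¹' {x | τ ≤ x} := by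
    ext x; simp [le_abs]
  have hneg : gaussianReal 0 (1 / 2) ((fun x => -x) ⁻¹' {x | τ ≤ x})
      = gaussianReal 0 (1 / 2) {x | τ ≤ x} := by
    have hm : MeasurableSet {x : ℝ | τ ≤ x} := measurableSet_Ici
    have := Measure.map_apply (μ := gaussianReal 0 (1 / 2)) (f := fun x => -x) (by fun_prop) hm
    rw [← this, gaussianReal_map_neg, neg_zero]
  rw [hsub, two_mul, ENNReal.ofReal_add (Real.exp_nonneg _) (Real.exp_nonneg _)]
  refine (measure_union_le _ _).trans ?_
  rw [hneg]
  exact add_le_add (gaussianReal_half_Ici_le hτ) (gaussianReal_half_Ici_le hτ)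

/-- Gaussians with nearby means are dominated, up to a factor close to one, by a single Gaussian of
slightly larger variance. -/
theorem exists_gaussianReal_half_le_smul {K : ℝ≥0} (hK : 1 < K) :
    ∃ b : ℝ, 0 < b ∧ ∃ v : ℝ≥0, ∀ m m' : ℝ, |m - m'| ≤ b →
      gaussianReal m (1 / 2) ≤ K • gaussianReal m' v := by
  have hK' : (1 : ℝ) < K := by exact_mod_cast hK
  have hK0 : (0 : ℝ) < K := by linarith
  have hlog : 0 < Real.log K := Real.log_pos hK'
  have hp : 0 < (K - 1 : ℝ) * (Real.log K / 2) := by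
    refine mul_pos (by linarith) (by positivity)
  -- Widening the variance from `1/2` to `K/2` uses a factor `√K` of the weight `K` for
  -- normalisation. The other `√K = exp (log K / 2)` pays for the shift, which limits its size to
  -- this radius.
  refine ⟨√((K - 1 : ℝ) * (Real.log K / 2)), Real.sqrt_pos.2 hp, K / 2, fun m m' hm => ?_⟩
  have hb2 : (m - m') ^ 2 ≤ (K - 1 : ℝ) * (Real.log K / 2) := by
    rw [← sq_abs, ← Real.sq_sqrt hp.le]
    exact pow_le_pow_left₀ (abs_nonneg _) hm 2
  have hv : K / 2 ≠ 0 := by positivity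
  rw [gaussianReal_of_var_ne_zero _ (by norm_num), gaussianReal_of_var_ne_zero _ hv]
  have : K • (volume.withDensity (gaussianPDF m' (K / 2)))
      = volume.withDensity ((K : ENNReal) • gaussianPDF m' (K / 2)) := by
    rw [withDensity_smul _ (measurable_gaussianPDF _ _)]; rfl
  rw [this]
  refine withDensity_mono (ae_of_all _ fun x => ?_)
  simp only [Pi.smul_apply, smul_eq_mul, gaussianPDF]
  rw [← ENNReal.ofReal_coe_nnreal, ← ENNReal.ofReal_mul hK0.le]
  refine ENNReal.ofReal_le_ofReal ?_
  unfold gaussianPDFReal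
  have hA : √(2 * Real.pi * ((K / 2 : ℝ≥0) : ℝ)) = √K * √Real.pi := by
    rw [← Real.sqrt_mul hK0.le]; congr 1; push_cast; ring
  have hB : √(2 * Real.pi * ((1 / 2 : ℝ≥0) : ℝ)) = √Real.pi := by
    congr 1; push_cast; ring
  rw [hA, hB, mul_inv]
  have hsK : 0 < √(K : ℝ) := Real.sqrt_pos.2 hK0
  have hKK : (K : ℝ) * (√(K : ℝ))⁻¹ = √K := by
    rw [← div_eq_mul_inv, Real.div_sqrt]
  have hKe : √(K : ℝ) = Real.exp (Real.log K / 2) := by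
    rw [Real.sqrt_eq_rpow, Real.rpow_def_of_pos hK0]; congr 1; ring
  calc (√Real.pi)⁻¹ * Real.exp (-(x - m) ^ 2 / (2 * ((1 / 2 : ℝ≥0) : ℝ)))
      ≤ (√Real.pi)⁻¹ * (Real.exp (Real.log K / 2) *
          Real.exp (-(x - m') ^ 2 / (2 * ((K / 2 : ℝ≥0) : ℝ)))) := by
        refine mul_le_mul_of_nonneg_left ?_ (by positivity)
        rw [← Real.exp_add]
        refine Real.exp_le_exp.2 ?_
        push_cast
        have h1 : -(x - m) ^ 2 / (2 * (1 / 2)) = -(x - m) ^ 2 := by ring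
        have h2 : -(x - m') ^ 2 / (2 * ((K : ℝ) / 2)) = -((x - m') ^ 2 / K) := by
          field_simp
        rw [h1, h2]
        have h3 : (x - m') ^ 2 ≤ K * ((x - m) ^ 2 + Real.log K / 2) := by
          -- Weighted Young inequality: the difference of the two sides is exactly the square passed
          -- to `nlinarith`.
          have h4 : (K - 1 : ℝ) * (x - m') ^ 2
              ≤ (K - 1) * (K * (x - m) ^ 2) + K * (m - m') ^ 2 := by
            nlinarith [sq_nonneg ((K - 1 : ℝ) * (x - m) - (m - m'))]
          have h5 : (K - 1 : ℝ) * (x - m') ^ 2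
              ≤ (K - 1) * (K * ((x - m) ^ 2 + Real.log K / 2)) := by
            nlinarith
          exact le_of_mul_le_mul_left h5 (by linarith)
        have h6 := (div_le_iff₀' hK0).2 h3
        linarith
    _ = K * ((√K)⁻¹ * (√Real.pi)⁻¹ *
          Real.exp (-(x - m') ^ 2 / (2 * ((K / 2 : ℝ≥0) : ℝ)))) := by
        rw [← hKe]
        nth_rewrite 1 [← hKK]
        ring

/-! ### Complex Gaussian estimates -/

instance : IsProbabilityMeasure stdComplexGaussian :=
  Measure.isProbabilityMeasure_map Complex.measurableEquivRealProd.symm.measurable.aemeasurable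

instance (N ν Mr : ℕ) : IsProbabilityMeasure (channelLaw N ν Mr) := by
  unfold channelLaw; infer_instance

theorem stdComplexGaussian_apply {s : Set ℂ} (hs : MeasurableSet s) :
    stdComplexGaussian s = ((gaussianReal 0 (1 / 2)).prod (gaussianReal 0 (1 / 2)))
      {q | (⟨q.1, q.2⟩ : ℂ) ∈ s} := by
  rw [stdComplexGaussian, Measure.map_apply Complex.measurableEquivRealProd.symm.measurable hs]
  rfl

/-- The disc lies in a square of side `2t` and the density is bounded. With the matching lower bound
below, a tap is weak at level `t` with probability of exact order `t²`. -/
theorem stdComplexGaussian_closedBall_le {t : ℝ} (ht : 0 ≤ t) :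
    stdComplexGaussian (Metric.closedBall 0 t) ≤ ENNReal.ofReal (4 * t ^ 2) := by
  rw [stdComplexGaussian_apply Metric.isClosed_closedBall.measurableSet]
  calc _ ≤ ((gaussianReal 0 (1 / 2)).prod (gaussianReal 0 (1 / 2)))
        (Set.Icc (-t) t ×ˢ Set.Icc (-t) t) := by
        refine measure_mono fun q hq => ?_
        have hq' : ‖(⟨q.1, q.2⟩ : ℂ)‖ ≤ t := by simpa using hq
        have h1 := (Complex.abs_re_le_norm (⟨q.1, q.2⟩ : ℂ)).trans hq'
        have h2 := (Complex.abs_im_le_norm (⟨q.1, q.2⟩ : ℂ)).trans hq'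
        exact ⟨abs_le.1 h1, abs_le.1 h2⟩
    _ ≤ ENNReal.ofReal (2 * t) * ENNReal.ofReal (2 * t) := by
        rw [Measure.prod_prod]
        exact mul_le_mul' (gaussianReal_half_Icc_le t) (gaussianReal_half_Icc_le t)
    _ = _ := by
        rw [← ENNReal.ofReal_mul (by positivity)]; congr 1; ring

theorem exists_le_stdComplexGaussian_closedBall : ∃ c : ℝ, 0 < c ∧ ∀ t : ℝ, 0 ≤ t → t ≤ 1 →
    ENNReal.ofReal (c * t ^ 2) ≤ stdComplexGaussian (Metric.closedBall 0 t) := by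
  obtain ⟨c, hc, h⟩ := exists_le_gaussianReal_half_Icc
  refine ⟨c ^ 2 / 4, by positivity, fun t ht0 ht => ?_⟩
  rw [stdComplexGaussian_apply Metric.isClosed_closedBall.measurableSet]
  calc ENNReal.ofReal (c ^ 2 / 4 * t ^ 2)
      = ENNReal.ofReal (c * (t / 2)) * ENNReal.ofReal (c * (t / 2)) := by
        rw [← ENNReal.ofReal_mul (by positivity)]; congr 1; ring
    _ ≤ ((gaussianReal 0 (1 / 2)).prod (gaussianReal 0 (1 / 2)))
        (Set.Icc (-(t / 2)) (t / 2) ×ˢ Set.Icc (-(t / 2)) (t / 2)) := by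
        rw [Measure.prod_prod]
        exact mul_le_mul' (h _ (by linarith)) (h _ (by linarith))
    _ ≤ _ := by
        refine measure_mono fun q hq => ?_
        have h1 := abs_le.2 hq.1
        have h2 := abs_le.2 hq.2
        have h3 := Complex.norm_le_abs_re_add_abs_im (⟨q.1, q.2⟩ : ℂ)
        have : ‖(⟨q.1, q.2⟩ : ℂ)‖ ≤ t := by dsimp only at h3; linarith
        simpa using this

theorem stdComplexGaussian_norm_ge_le {τ : ℝ} (hτ : 0 ≤ τ) :
    stdComplexGaussian {w | τ ≤ ‖w‖} ≤ ENNReal.ofReal (4 * Real.exp (-τ ^ 2 / 4)) := by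
  rw [stdComplexGaussian_apply (measurableSet_le measurable_const measurable_norm)]
  set S : Set ℝ := {x | τ / 2 ≤ |x|}
  have hS : gaussianReal 0 (1 / 2) S ≤ ENNReal.ofReal (2 * Real.exp (-(τ / 2) ^ 2)) :=
    gaussianReal_half_abs_ge_le (by positivity)
  calc _ ≤ ((gaussianReal 0 (1 / 2)).prod (gaussianReal 0 (1 / 2)))
        (S ×ˢ Set.univ ∪ Set.univ ×ˢ S) := by
        refine measure_mono fun q hq => ?_
        have h3 := Complex.norm_le_abs_re_add_abs_im (⟨q.1, q.2⟩ : ℂ)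
        have hq' : τ ≤ ‖(⟨q.1, q.2⟩ : ℂ)‖ := hq
        dsimp only at h3
        by_cases h : τ / 2 ≤ |q.1|
        · exact Or.inl ⟨h, trivial⟩
        · refine Or.inr ⟨trivial, ?_⟩
          change τ / 2 ≤ |q.2|
          linarith
    _ ≤ ENNReal.ofReal (2 * Real.exp (-(τ / 2) ^ 2))
          + ENNReal.ofReal (2 * Real.exp (-(τ / 2) ^ 2)) := by
        refine (measure_union_le _ _).trans ?_
        rw [Measure.prod_prod, Measure.prod_prod, measure_univ, mul_one, one_mul]
        exact add_le_add hS hS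
    _ = _ := by
        rw [← ENNReal.ofReal_add (by positivity) (by positivity)]
        congr 1
        have : -(τ / 2) ^ 2 = -τ ^ 2 / 4 := by ring
        rw [this]; ring

/-! ### Arrays of i.i.d. complex Gaussians -/

/-- A sup-norm ball is a product of discs. For the taps the power is `Mr * (ν + 1)`, the full
diversity order. -/
theorem iidGaussian_closedBall (k l : ℕ) {t : ℝ} (ht : 0 ≤ t) :
    (Measure.pi fun _ : Fin k => Measure.pi fun _ : Fin l => stdComplexGaussian)
      {h : Fin k → Fin l → ℂ | ‖h‖ ≤ t}
      = stdComplexGaussian (Metric.closedBall 0 t) ^ (l * k) := by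
  have : {h : Fin k → Fin l → ℂ | ‖h‖ ≤ t} = Metric.closedBall 0 t := by
    ext h; simp
  rw [this, Measure.pi_closedBall _ _ ht]
  simp_rw [Pi.zero_apply]
  simp_rw [Measure.pi_closedBall (fun _ : Fin l => stdComplexGaussian) _ ht]
  simp [pow_mul]

theorem iidGaussian_norm_ge_le (k l : ℕ) {τ : ℝ} (hτ : 0 < τ) :
    (Measure.pi fun _ : Fin k => Measure.pi fun _ : Fin l => stdComplexGaussian)
      {z : Fin k → Fin l → ℂ | τ ≤ ‖z‖}
      ≤ ENNReal.ofReal (k * l * 4 * Real.exp (-τ ^ 2 / 4)) := by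
  set P := Measure.pi fun _ : Fin k => Measure.pi fun _ : Fin l => stdComplexGaussian
  have hsub : {z : Fin k → Fin l → ℂ | τ ≤ ‖z‖} ⊆
      ⋃ n : Fin k, ⋃ p : Fin l, {z | τ ≤ ‖z n p‖} := by
    intro z hz
    by_contra hcon
    simp only [Set.mem_iUnion, Set.mem_ofPred_eq, not_exists, not_le] at hcon
    have : ‖z‖ < τ := (pi_norm_lt_iff hτ).2 fun n => (pi_norm_lt_iff hτ).2 fun p => hcon n p
    exact absurd hz (not_le.2 this)
  have hmp : ∀ n p, MeasurePreserving (fun z : Fin k → Fin l → ℂ => z n p) P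
      stdComplexGaussian := fun n p =>
    (measurePreserving_eval (fun _ : Fin l => stdComplexGaussian) p).comp
      (measurePreserving_eval
        (fun _ : Fin k => Measure.pi fun _ : Fin l => stdComplexGaussian) n)
  calc P {z | τ ≤ ‖z‖} ≤ P (⋃ n : Fin k, ⋃ p : Fin l, {z | τ ≤ ‖z n p‖}) := measure_mono hsub
    _ ≤ ∑ n : Fin k, ∑ p : Fin l, P {z | τ ≤ ‖z n p‖} :=
        (measure_iUnion_fintype_le _ _).trans
          (Finset.sum_le_sum fun n _ => measure_iUnion_fintype_le _ _)
    _ ≤ ∑ n : Fin k, ∑ p : Fin l, ENNReal.ofReal (4 * Real.exp (-τ ^ 2 / 4)) := by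
        refine Finset.sum_le_sum fun n _ => Finset.sum_le_sum fun p _ => ?_
        refine le_trans (le_of_eq ?_) (stdComplexGaussian_norm_ge_le hτ.le)
        exact (hmp n p).measure_preimage
          (measurableSet_le measurable_const measurable_norm).nullMeasurableSet
    _ = _ := by
        simp only [Finset.sum_const, Finset.card_univ, Fintype.card_fin, nsmul_eq_mul]
        rw [← ENNReal.ofReal_natCast k, ← ENNReal.ofReal_natCast l,
          ← ENNReal.ofReal_mul (by positivity), ← ENNReal.ofReal_mul (by positivity)]
        congr 1; ring

/-! ### Domination of shifted Gaussian arrays -/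

/-- The product outer measure is the largest one bounded on boxes by the products of the factors, so
comparing on boxes suffices. Only the smaller family has to be σ-finite. -/
theorem pi_mono_of_le {ι : Type*} [Fintype ι] {X : ι → Type*} [∀ i, MeasurableSpace (X i)]
    {μ μ' : ∀ i, Measure (X i)} [∀ i, SigmaFinite (μ i)]
    (h : ∀ i, μ i ≤ μ' i) : Measure.pi μ ≤ Measure.pi μ' := by
  refine Measure.le_iff'.2 fun s => ?_
  have hle : (Measure.pi μ).toOuterMeasure ≤
      OuterMeasure.pi fun i => (μ' i).toOuterMeasure := by
    refine OuterMeasure.le_pi.2 fun s _ => ?_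
    exact (Measure.pi_pi μ s).le.trans (Finset.prod_le_prod' fun i _ => h i (s i))
  exact (hle s).trans (by rw [Measure.pi]; exact le_toMeasure_apply _ _ s)

/-- Shifted complex Gaussians with nearby shifts are dominated by a common measure whose mass is
close to one. -/
theorem exists_stdComplexGaussian_shift_le {K : ℝ≥0} (hK : 1 < K) :
    ∃ b : ℝ, 0 < b ∧ ∀ c : ℂ, ∃ ρ : Measure ℂ, ρ Set.univ = K ^ 2 ∧ ∀ a : ℂ, ‖a - c‖ ≤ b →
      stdComplexGaussian.map (fun w => a + w) ≤ ρ := by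
  obtain ⟨b, hb, v, h⟩ := exists_gaussianReal_half_le_smul hK
  refine ⟨b, hb, fun c => ⟨((K • gaussianReal c.re v).prod (K • gaussianReal c.im v)).map
    Complex.measurableEquivRealProd.symm, ?_, fun a ha => ?_⟩⟩
  · rw [Measure.map_apply Complex.measurableEquivRealProd.symm.measurable MeasurableSet.univ,
      Set.preimage_univ, ← Set.univ_prod_univ, Measure.prod_prod]
    rw [Measure.smul_apply, Measure.smul_apply, measure_univ, measure_univ, ENNReal.smul_def,
      smul_eq_mul, mul_one, sq]
  · have h1 := h a.re c.re ((Complex.abs_re_le_norm (a - c)).trans ha)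
    have h2 := h a.im c.im ((Complex.abs_im_le_norm (a - c)).trans ha)
    have hmap : stdComplexGaussian.map (fun w => a + w) =
        ((gaussianReal a.re (1 / 2)).prod (gaussianReal a.im (1 / 2))).map
          Complex.measurableEquivRealProd.symm := by
      have e1 := gaussianReal_map_const_add (μ := 0) (v := 1 / 2) a.re
      have e2 := gaussianReal_map_const_add (μ := 0) (v := 1 / 2) a.im
      rw [zero_add] at e1 e2
      rw [← e1, ← e2, Measure.map_prod_map _ _ (by fun_prop) (by fun_prop), stdComplexGaussian,
        Measure.map_map (by fun_prop) Complex.measurableEquivRealProd.symm.measurable,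
        Measure.map_map Complex.measurableEquivRealProd.symm.measurable (by fun_prop)]
      congr 1
    rw [hmap]
    exact Measure.map_mono (Measure.prod_mono h1 h2)
      Complex.measurableEquivRealProd.symm.measurable

/-- Coordinatewise domination tensorizes, at total mass `K ^ (2kl)`, and `K` is taken close enough
to one. The constant `6/5` only has to leave `1/10 + (6/5)/2 < 1` in the outage bound. -/
theorem exists_iidGaussian_shift_le (k l : ℕ) :
    ∃ b : ℝ, 0 < b ∧ ∀ c : Fin k → Fin l → ℂ, ∃ ρ : Measure (Fin k → Fin l → ℂ),
      ρ Set.univ ≤ ENNReal.ofReal (6 / 5) ∧ ∀ a : Fin k → Fin l → ℂ, ‖a - c‖ ≤ b →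
      (Measure.pi fun _ : Fin k => Measure.pi fun _ : Fin l => stdComplexGaussian).map
        (fun z => a + z) ≤ ρ := by
  obtain ⟨K, hK1, hKp⟩ : ∃ K : ℝ≥0, 1 < K ∧ ((K ^ 2) ^ l) ^ k ≤ 6 / 5 := by
    have hcont : Tendsto (fun K : ℝ≥0 => ((K ^ 2) ^ l) ^ k) (nhdsWithin 1 (Set.Ioi 1))
        (nhds (((1 ^ 2) ^ l) ^ k)) :=
      (Continuous.tendsto (by fun_prop) 1).mono_left nhdsWithin_le_nhds
    have h65 : (((1 : ℝ≥0) ^ 2) ^ l) ^ k < 6 / 5 := by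
      simp only [one_pow]
      rw [lt_div_iff₀ (by norm_num)]; norm_num
    obtain ⟨K, hK, hK'⟩ := ((hcont.eventually_le_const h65).and self_mem_nhdsWithin).exists
    exact ⟨K, hK', hK⟩
  obtain ⟨b, hb, h⟩ := exists_stdComplexGaussian_shift_le hK1
  choose ρ hρ1 hρ2 using h
  have hfin : ∀ c, IsFiniteMeasure (ρ c) := fun c => ⟨by
    rw [hρ1]; exact ENNReal.pow_lt_top ENNReal.coe_lt_top⟩
  refine ⟨b, hb, fun c => ⟨Measure.pi fun n => Measure.pi fun p => ρ (c n p), ?_, ?_⟩⟩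
  · rw [Measure.pi_univ]
    simp_rw [Measure.pi_univ, hρ1]
    simp only [Finset.prod_const, Finset.card_univ, Fintype.card_fin]
    rw [← ENNReal.coe_pow, ← ENNReal.coe_pow, ← ENNReal.coe_pow, ENNReal.ofReal]
    refine ENNReal.coe_le_coe.2 (hKp.trans (le_of_eq ?_))
    rw [← NNReal.coe_inj, Real.coe_toNNReal _ (by norm_num)]
    norm_num
  · intro a ha
    have hsf : ∀ n p, IsProbabilityMeasure (stdComplexGaussian.map fun w => a n p + w) :=
      fun n p => Measure.isProbabilityMeasure_map (by fun_prop)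
    have hin : ∀ n, (Measure.pi fun _ : Fin l => stdComplexGaussian).map (fun z => a n + z)
        = Measure.pi fun p => stdComplexGaussian.map fun w => a n p + w := fun n => by
      rw [← Measure.pi_map_pi (fun p => by fun_prop)]
      rfl
    have hsf' : ∀ n, IsProbabilityMeasure
        ((Measure.pi fun _ : Fin l => stdComplexGaussian).map fun z => a n + z) :=
      fun n => Measure.isProbabilityMeasure_map (by fun_prop)
    have hout : (Measure.pi fun _ : Fin k => Measure.pi fun _ : Fin l => stdComplexGaussian).map
        (fun z => a + z) = Measure.pi fun n =>
          (Measure.pi fun _ : Fin l => stdComplexGaussian).map fun z => a n + z := by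
      rw [← Measure.pi_map_pi (fun n => by fun_prop)]
      rfl
    rw [hout]
    refine pi_mono_of_le fun n => ?_
    rw [hin]
    refine pi_mono_of_le fun p => hρ2 _ _ ?_
    exact (norm_le_pi_norm ((a - c) n) p).trans ((norm_le_pi_norm (a - c) n).trans ha)

/-! ### The noiseless channel -/

theorem received_eq_add {N ν Mr : ℕ} (h : Taps ν Mr) (x : Fin (N + ν) → ℂ)
    (z : Samples N ν Mr) : received h x z = received h x 0 + z := by
  funext n p
  simp [received]

theorem received_sub {N ν Mr : ℕ} (h : Taps ν Mr) (x x' : Fin (N + ν) → ℂ) :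
    (received h x 0 : Samples N ν Mr) - received h x' 0 = received h (x - x') 0 := by
  funext n p
  simp only [received, Pi.sub_apply, Pi.zero_apply, add_zero, ← Finset.sum_sub_distrib]
  refine Finset.sum_congr rfl fun m _ => ?_
  split_ifs <;> ring

theorem norm_received_le {N ν Mr : ℕ} (h : Taps ν Mr) (x : Fin (N + ν) → ℂ) :
    ‖(received h x 0 : Samples N ν Mr)‖ ≤ ((ν : ℝ) + 1) * ‖h‖ * ‖x‖ := by
  have hnn : 0 ≤ ((ν : ℝ) + 1) * ‖h‖ * ‖x‖ := by positivity
  refine (pi_norm_le_iff_of_nonneg hnn).2 fun n => (pi_norm_le_iff_of_nonneg hnn).2 fun p => ?_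
  simp only [received, Pi.zero_apply, add_zero]
  calc _ ≤ ∑ _m : Fin (ν + 1), ‖h‖ * ‖x‖ := by
        refine norm_sum_le_of_le _ fun m _ => ?_
        rw [norm_mul]
        refine mul_le_mul ((norm_le_pi_norm (h m) p).trans (norm_le_pi_norm h m)) ?_
          (norm_nonneg _) (norm_nonneg _)
        split_ifs
        · exact norm_le_pi_norm x _
        · simp
    _ = _ := by
        simp only [Finset.sum_const, Finset.card_univ, Fintype.card_fin, nsmul_eq_mul]
        push_cast; ring

theorem measurable_received {N ν Mr : ℕ} (x : Fin (N + ν) → ℂ) :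
    Measurable fun q : Taps ν Mr × Samples N ν Mr => received q.1 x q.2 := by
  unfold received
  fun_prop

/-! ### Lower bound on the error probability -/

/-- If finitely many shifts fall into few small balls, the correct decoding probabilities cannot
add up to much more than the number of balls. -/
theorem sum_correct_le_card {k l : ℕ} {b : ℝ}
    (hb : ∀ c : Fin k → Fin l → ℂ, ∃ ρ : Measure (Fin k → Fin l → ℂ),
      ρ Set.univ ≤ ENNReal.ofReal (6 / 5) ∧ ∀ a : Fin k → Fin l → ℂ, ‖a - c‖ ≤ b →
      (Measure.pi fun _ : Fin k => Measure.pi fun _ : Fin l => stdComplexGaussian).map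
        (fun z => a + z) ≤ ρ)
    {I Q : Type*} [MeasurableSpace I] [MeasurableSingletonClass I] [DecidableEq Q]
    (G : Finset I) (a : I → Fin k → Fin l → ℂ)
    {dec : (Fin k → Fin l → ℂ) → I} (hdec : Measurable dec)
    (S : Finset Q) (κ : I → Q) (hκ : ∀ i ∈ G, κ i ∈ S) (ctr : Q → Fin k → Fin l → ℂ)
    (hctr : ∀ i ∈ G, ‖a i - ctr (κ i)‖ ≤ b) :
    ∑ i ∈ G, (Measure.pi fun _ : Fin k => Measure.pi fun _ : Fin l => stdComplexGaussian).real
      {z | dec (a i + z) = i} ≤ 6 / 5 * S.card := by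
  set γ := Measure.pi fun _ : Fin k => Measure.pi fun _ : Fin l => stdComplexGaussian
  have hD : ∀ i, MeasurableSet {y | dec y = i} := fun i => hdec (measurableSet_singleton i)
  -- Within one cell all output laws lie below the same `ρ`. The decision regions are disjoint, so
  -- their `ρ`-masses add up to at most its total mass.
  have key : ∀ q ∈ S, ∑ i ∈ G with κ i = q, γ {z | dec (a i + z) = i}
      ≤ ENNReal.ofReal (6 / 5) := by
    intro q _
    obtain ⟨ρ, hρ, h⟩ := hb (ctr q)
    calc ∑ i ∈ G with κ i = q, γ {z | dec (a i + z) = i}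
        ≤ ∑ i ∈ G with κ i = q, ρ {y | dec y = i} := by
          refine Finset.sum_le_sum fun i hi => ?_
          rw [Finset.mem_filter] at hi
          have h1 := h (a i) (hi.2 ▸ hctr i hi.1) {y | dec y = i}
          rwa [Measure.map_apply (by fun_prop) (hD i)] at h1
      _ = ρ (⋃ i ∈ G.filter fun i => κ i = q, {y | dec y = i}) := by
          refine (measure_biUnion_finset ?_ fun i _ => hD i).symm
          intro i _ j _ hij
          refine Set.disjoint_left.2 fun y hy hy' => hij ?_
          exact (show dec y = i from hy).symm.trans hy'
      _ ≤ _ := (measure_mono (Set.subset_univ _)).trans hρ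
  have htot : ∑ i ∈ G, γ {z | dec (a i + z) = i} ≤ ENNReal.ofReal (6 / 5 * S.card) := by
    rw [← Finset.sum_fiberwise_of_maps_to hκ]
    refine (Finset.sum_le_sum key).trans ?_
    rw [Finset.sum_const, nsmul_eq_mul, mul_comm, ENNReal.ofReal_mul (by norm_num),
      ENNReal.ofReal_natCast]
  have := ENNReal.toReal_mono ENNReal.ofReal_ne_top htot
  rwa [ENNReal.toReal_sum fun i _ => measure_ne_top _ _,
    ENNReal.toReal_ofReal (by positivity)] at this

/-- Rounding to the nearest grid point makes the bound vanish as soon as `r < w / 2`, leaving a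
single cell. Codes with only two messages need this. -/
theorem natAbs_round_le_floor {v r w : ℝ} (hw : 0 < w) (hv : |v| ≤ r) :
    (round (v / w)).natAbs ≤ ⌊r / w + 1 / 2⌋₊ := by
  refine Nat.le_floor ?_
  rw [Nat.cast_natAbs, Int.cast_abs]
  have h1 := abs_sub_round (v / w)
  have h2 : |v / w| ≤ r / w := by
    rw [abs_div, abs_of_pos hw]; exact div_le_div_of_nonneg_right hv hw.le
  have h3 : |(round (v / w) : ℝ)| ≤ |v / w| + |v / w - round (v / w)| := by
    have := abs_sub (v / w) (v / w - round (v / w))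
    simpa using this
  linarith

theorem abs_sub_mul_round_le {v w : ℝ} (hw : 0 < w) : |v - w * round (v / w)| ≤ w / 2 := by
  have h1 := abs_sub_round (v / w)
  have : v - w * round (v / w) = w * (v / w - round (v / w)) := by field_simp
  rw [this, abs_mul, abs_of_pos hw]
  nlinarith

/-- For weak taps, the codewords of bounded amplitude are decoded correctly with total probability
at most of the order of the number of distinguishable noiseless outputs. -/
theorem sum_correct_le {N ν Mr : ℕ} {b : ℝ} (hb0 : 0 < b)
    (hb : ∀ c : Fin (N + ν) → Fin Mr → ℂ, ∃ ρ : Measure (Fin (N + ν) → Fin Mr → ℂ),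
      ρ Set.univ ≤ ENNReal.ofReal (6 / 5) ∧ ∀ a : Fin (N + ν) → Fin Mr → ℂ, ‖a - c‖ ≤ b →
      (Measure.pi fun _ : Fin (N + ν) => Measure.pi fun _ : Fin Mr => stdComplexGaussian).map
        (fun z => a + z) ≤ ρ)
    {I : Type*} [MeasurableSpace I] [MeasurableSingletonClass I]
    (G : Finset I) (x : I → Fin (N + ν) → ℂ) {r t : ℝ} (ht : 0 < t)
    (hG : ∀ i ∈ G, ‖x i‖ ≤ r) {h : Taps ν Mr} (hh : ‖h‖ ≤ t)
    {dec : Samples N ν Mr → I} (hdec : Measurable dec) :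
    ∑ i ∈ G,
      (Measure.pi fun _ : Fin (N + ν) => Measure.pi fun _ : Fin Mr => stdComplexGaussian).real
      {z | dec (received h (x i) z) = i}
      ≤ 6 / 5 * (2 * ⌊r * (ν + 1) * t / b + 1 / 2⌋₊ + 1 : ℝ) ^ (2 * (N + ν)) := by
  -- The channel stretches input distances by at most `(ν + 1) t`, so inputs within `w` of a grid
  -- point have outputs within `b` of its image.
  set w : ℝ := b / ((ν + 1) * t) with hw_def
  have hw : 0 < w := by positivity
  have hrw : r * (ν + 1) * t / b = r / w := by rw [hw_def]; field_simp
  rw [hrw]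
  set u : ℕ := ⌊r / w + 1 / 2⌋₊
  let κ : I → Fin (N + ν) → ℤ × ℤ := fun i n => (round ((x i n).re / w), round ((x i n).im / w))
  let pt : (Fin (N + ν) → ℤ × ℤ) → Fin (N + ν) → ℂ := fun q n => ⟨w * (q n).1, w * (q n).2⟩
  have hκ : ∀ i ∈ G, κ i ∈ Fintype.piFinset fun _ : Fin (N + ν) =>
      Finset.Icc (-(u : ℤ)) u ×ˢ Finset.Icc (-(u : ℤ)) u := by
    intro i hi
    refine Fintype.mem_piFinset.2 fun n => ?_
    have hn := (norm_le_pi_norm (x i) n).trans (hG i hi)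
    have h1 := natAbs_round_le_floor hw ((Complex.abs_re_le_norm _).trans hn)
    have h2 := natAbs_round_le_floor hw ((Complex.abs_im_le_norm _).trans hn)
    simp only [Finset.mem_product, Finset.mem_Icc, κ]
    change _ ≤ u at h1
    change _ ≤ u at h2
    omega
  have hctr : ∀ i ∈ G, ‖(received h (x i) 0 : Samples N ν Mr)
      - (fun q => received h (pt q) 0) (κ i)‖ ≤ b := by
    intro i _
    simp only
    rw [received_sub]
    have hx : ‖x i - pt (κ i)‖ ≤ w := by
      refine (pi_norm_le_iff_of_nonneg hw.le).2 fun n => ?_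
      refine (Complex.norm_le_abs_re_add_abs_im _).trans ?_
      have h1 := abs_sub_mul_round_le (v := (x i n).re) hw
      have h2 := abs_sub_mul_round_le (v := (x i n).im) hw
      simp only [Pi.sub_apply, Complex.sub_re, Complex.sub_im, pt, κ]
      linarith
    calc _ ≤ ((ν : ℝ) + 1) * ‖h‖ * ‖x i - pt (κ i)‖ := norm_received_le _ _
      _ ≤ ((ν : ℝ) + 1) * t * w := by gcongr
      _ = b := by rw [hw_def]; field_simp
  have := sum_correct_le_card hb G (fun i => (received h (x i) 0 : Samples N ν Mr)) hdec _ κ hκ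
    (fun q => received h (pt q) 0) hctr
  simp_rw [← received_eq_add] at this
  refine this.trans (le_of_eq ?_)
  rw [Fintype.card_piFinset_const, Finset.card_product, Int.card_Icc]
  have : ((u : ℤ) + 1 - -(u : ℤ)).toNat = 2 * u + 1 := by omega
  rw [this, pow_mul, sq]
  push_cast
  rfl

/-- Few codewords have energy much above the average. -/
theorem card_filter_norm_gt_le {n : ℕ} {ι : Type*} [Fintype ι] (x : ι → Fin n → ℂ) {s : ℝ}
    (hs : 0 < s) (hx : ∑ i, ∑ m, ‖x i m‖ ^ 2 ≤ Fintype.card ι * s) :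
    ((Finset.univ.filter fun i => √(10 * s) < ‖x i‖).card : ℝ) ≤ Fintype.card ι / 10 := by
  set B := Finset.univ.filter fun i => √(10 * s) < ‖x i‖
  have h1 : ∀ i ∈ B, 10 * s ≤ ∑ m, ‖x i m‖ ^ 2 := by
    intro i hi
    have hi' : √(10 * s) < ‖x i‖ := (Finset.mem_filter.1 hi).2
    by_contra! hcon
    refine absurd hi' (not_lt.2 ((pi_norm_le_iff_of_nonneg (Real.sqrt_nonneg _)).2 fun m => ?_))
    refine Real.le_sqrt_of_sq_le (le_trans ?_ hcon.le)
    exact Finset.single_le_sum (f := fun m => ‖x i m‖ ^ 2) (fun m _ => by positivity)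
      (Finset.mem_univ m)
  have h2 : (B.card : ℝ) * (10 * s) ≤ Fintype.card ι * s := by
    calc (B.card : ℝ) * (10 * s) = ∑ _i ∈ B, 10 * s := by simp
      _ ≤ ∑ i ∈ B, ∑ m, ‖x i m‖ ^ 2 := Finset.sum_le_sum h1
      _ ≤ ∑ i, ∑ m, ‖x i m‖ ^ 2 :=
          Finset.sum_le_sum_of_subset_of_nonneg (Finset.subset_univ _)
            fun i _ _ => Finset.sum_nonneg fun m _ => by positivity
      _ ≤ _ := hx
  have h3 : (B.card : ℝ) * 10 ≤ Fintype.card ι :=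
    le_of_mul_le_mul_right (by linarith) hs
  linarith

/-- Outage lower bound: for a code with more messages than can be resolved through weak taps, the
average error probability is at least of the order of the probability of weak taps. -/
theorem outage_le_sum_err {N ν Mr : ℕ} {b : ℝ} (hb0 : 0 < b)
    (hb : ∀ c : Fin (N + ν) → Fin Mr → ℂ, ∃ ρ : Measure (Fin (N + ν) → Fin Mr → ℂ),
      ρ Set.univ ≤ ENNReal.ofReal (6 / 5) ∧ ∀ a : Fin (N + ν) → Fin Mr → ℂ, ‖a - c‖ ≤ b →
      (Measure.pi fun _ : Fin (N + ν) => Measure.pi fun _ : Fin Mr => stdComplexGaussian).map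
        (fun z => a + z) ≤ ρ)
    {I J : Type*} [Fintype I] [Fintype J] [MeasurableSpace I] [MeasurableSingletonClass I]
    (x : I → J → Fin (N + ν) → ℂ) {s t : ℝ} (hs : 0 < s) (ht : 0 < t)
    (hx : ∑ i, ∑ j, ∑ n, ‖x i j n‖ ^ 2 ≤ Fintype.card I * Fintype.card J * s)
    {dec : Taps ν Mr → Samples N ν Mr → I}
    (hdec : Measurable fun q : Taps ν Mr × Samples N ν Mr => dec q.1 q.2)
    (hcard : (2 * ⌊√(10 * s) * (ν + 1) * t / b + 1 / 2⌋₊ + 1 : ℝ) ^ (2 * (N + ν))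
      ≤ Fintype.card I / 2) :
    3 / 10 * (Fintype.card I * Fintype.card J) *
      (stdComplexGaussian.real (Metric.closedBall 0 t)) ^ (Mr * (ν + 1))
      ≤ ∑ i, ∑ j, (channelLaw N ν Mr).real {q | dec q.1 (received q.1 (x i j) q.2) ≠ i} := by
  classical
  set γ := Measure.pi fun _ : Fin (N + ν) => Measure.pi fun _ : Fin Mr => stdComplexGaussian
    with hγ
  set P := Measure.pi fun _ : Fin (ν + 1) => Measure.pi fun _ : Fin Mr => stdComplexGaussian
    with hP
  have hdec' : ∀ h, Measurable (dec h) := fun h => hdec.comp measurable_prodMk_left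
  have hmeas : ∀ i j, MeasurableSet
      {q : Taps ν Mr × Samples N ν Mr | dec q.1 (received q.1 (x i j) q.2) ≠ i} := fun i j =>
    (hdec.comp (measurable_fst.prodMk (measurable_received (x i j))))
      (measurableSet_singleton i).compl
  have hcond : ∀ h : Taps ν Mr, ‖h‖ ≤ t → 3 / 10 * (Fintype.card I * Fintype.card J : ℝ) ≤
      ∑ i, ∑ j, γ.real {z | dec h (received h (x i j) z) ≠ i} := by
    intro h hh
    have hcm : ∀ i j, MeasurableSet {z | dec h (received h (x i j) z) = i} := fun i j =>
      ((hdec' h).comp ((measurable_received (x i j)).comp measurable_prodMk_left))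
        (measurableSet_singleton i)
    have hcompl : ∀ i j, γ.real {z | dec h (received h (x i j) z) ≠ i}
        = 1 - γ.real {z | dec h (received h (x i j) z) = i} := fun i j =>
      probReal_compl_eq_one_sub (hcm i j)
    set B := Finset.univ.filter fun p : I × J => √(10 * s) < ‖x p.1 p.2‖
    have hB : (B.card : ℝ) ≤ (Fintype.card I * Fintype.card J : ℝ) / 10 := by
      have := card_filter_norm_gt_le (fun p : I × J => x p.1 p.2) hs
        (by rw [Fintype.sum_prod_type, Fintype.card_prod]; push_cast; exact hx)
      rwa [Fintype.card_prod, Nat.cast_mul] at this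
    -- Codewords of excessive energy count as always correct, at most a tenth of them. For the rest
    -- the cells are counted separately for each `j`, so only the number of messages `i` matters.
    have hsum : ∑ i, ∑ j, γ.real {z | dec h (received h (x i j) z) = i}
        ≤ (Fintype.card I * Fintype.card J : ℝ) / 10
          + Fintype.card J * (6 / 5 * (Fintype.card I / 2)) := by
      calc ∑ i, ∑ j, γ.real {z | dec h (received h (x i j) z) = i}
          ≤ ∑ i, ∑ j, ((if √(10 * s) < ‖x i j‖ then 1 else 0)
            + if ‖x i j‖ ≤ √(10 * s) then
                γ.real {z | dec h (received h (x i j) z) = i} else 0) := by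
            refine Finset.sum_le_sum fun i _ => Finset.sum_le_sum fun j _ => ?_
            rcases lt_or_ge (√(10 * s)) ‖x i j‖ with hlt | hge
            · rw [if_pos hlt, if_neg (not_le.2 hlt), add_zero]
              exact measureReal_le_one
            · rw [if_neg (not_lt.2 hge), if_pos hge, zero_add]
        _ = (B.card : ℝ) + ∑ j, ∑ i, (if ‖x i j‖ ≤ √(10 * s) then
                γ.real {z | dec h (received h (x i j) z) = i} else 0) := by
            simp_rw [Finset.sum_add_distrib]
            congr 1
            · rw [← Fintype.sum_prod_type', Finset.sum_boole]
            · exact Finset.sum_comm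
        _ ≤ (Fintype.card I * Fintype.card J : ℝ) / 10
              + ∑ _j : J, 6 / 5 * (Fintype.card I / 2 : ℝ) := by
            refine add_le_add hB (Finset.sum_le_sum fun j _ => ?_)
            rw [← Finset.sum_filter]
            refine (sum_correct_le hb0 hb _ (fun i => x i j) ht
              (fun i hi => (Finset.mem_filter.1 hi).2) hh (hdec' h)).trans ?_
            gcongr
        _ = _ := by simp
    simp_rw [hcompl, Finset.sum_sub_distrib]
    simp only [Finset.sum_const, Finset.card_univ, nsmul_eq_mul, mul_one]
    linarith
  have hPA : P {h | ‖h‖ ≤ t} = ENNReal.ofReal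
      ((stdComplexGaussian.real (Metric.closedBall 0 t)) ^ (Mr * (ν + 1))) := by
    rw [hP, iidGaussian_closedBall _ _ ht.le, ENNReal.ofReal_pow measureReal_nonneg,
      measureReal_def, ENNReal.ofReal_toReal (measure_ne_top _ _)]
  have hmain : ENNReal.ofReal (3 / 10 * (Fintype.card I * Fintype.card J)) * P {h | ‖h‖ ≤ t}
      ≤ ∑ i, ∑ j, channelLaw N ν Mr {q | dec q.1 (received q.1 (x i j) q.2) ≠ i} := by
    have hsec : ∀ i j, channelLaw N ν Mr {q | dec q.1 (received q.1 (x i j) q.2) ≠ i}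
        = ∫⁻ h, γ {z | dec h (received h (x i j) z) ≠ i} ∂P := fun i j =>
      Measure.prod_apply (hmeas i j)
    have hsm : ∀ i j, Measurable fun h => γ {z | dec h (received h (x i j) z) ≠ i} := fun i j =>
      measurable_measure_prodMk_left (hmeas i j)
    simp_rw [hsec]
    have : ∑ i, ∑ j, ∫⁻ h, γ {z | dec h (received h (x i j) z) ≠ i} ∂P
        = ∫⁻ h, ∑ i, ∑ j, γ {z | dec h (received h (x i j) z) ≠ i} ∂P := by
      rw [lintegral_finsetSum _ fun i _ => Finset.measurable_fun_sum _ fun j _ => hsm i j]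
      refine Finset.sum_congr rfl fun i _ => ?_
      rw [lintegral_finsetSum _ fun j _ => hsm i j]
    rw [this, ← setLIntegral_const]
    refine le_trans ?_ (setLIntegral_le_lintegral {h | ‖h‖ ≤ t} _)
    refine setLIntegral_mono
      (Finset.measurable_fun_sum _ fun i _ => Finset.measurable_fun_sum _ fun j _ => hsm i j)
      fun h hh => ?_
    refine (ENNReal.ofReal_le_ofReal (hcond h hh)).trans (le_of_eq ?_)
    rw [ENNReal.ofReal_sum_of_nonneg fun i _ => Finset.sum_nonneg fun j _ => measureReal_nonneg]
    refine Finset.sum_congr rfl fun i _ => ?_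
    rw [ENNReal.ofReal_sum_of_nonneg fun j _ => measureReal_nonneg]
    refine Finset.sum_congr rfl fun j _ => ?_
    rw [measureReal_def, ENNReal.ofReal_toReal (measure_ne_top _ _)]
  rw [hPA, ← ENNReal.ofReal_mul (by positivity)] at hmain
  have hfin : ∑ i, ∑ j, channelLaw N ν Mr {q | dec q.1 (received q.1 (x i j) q.2) ≠ i}
      = ENNReal.ofReal
        (∑ i, ∑ j, (channelLaw N ν Mr).real {q | dec q.1 (received q.1 (x i j) q.2) ≠ i}) := by
    rw [ENNReal.ofReal_sum_of_nonneg fun i _ => Finset.sum_nonneg fun j _ => measureReal_nonneg]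
    refine Finset.sum_congr rfl fun i _ => ?_
    rw [ENNReal.ofReal_sum_of_nonneg fun j _ => measureReal_nonneg]
    refine Finset.sum_congr rfl fun j _ => ?_
    rw [measureReal_def, ENNReal.ofReal_toReal (measure_ne_top _ _)]
  rw [hfin] at hmain
  exact (ENNReal.ofReal_le_ofReal_iff (Finset.sum_nonneg fun i _ =>
    Finset.sum_nonneg fun j _ => measureReal_nonneg)).1 hmain

/-! ### Power-law asymptotics of the outage bound -/

theorem tendsto_coe_nnreal_atTop : Tendsto (fun s : ℝ≥0 => (s : ℝ)) atTop atTop :=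
  NNReal.tendsto_coe_atTop.2 tendsto_id

theorem eventually_one_lt_coe_nnreal : ∀ᶠ s : ℝ≥0 in atTop, (1 : ℝ) < s :=
  tendsto_coe_nnreal_atTop.eventually_gt_atTop 1

theorem tendsto_log_coe_nnreal_atTop : Tendsto (fun s : ℝ≥0 => Real.log s) atTop atTop :=
  Real.tendsto_log_atTop.comp tendsto_coe_nnreal_atTop

/-- Below the outage threshold the number of resolvable cells is eventually at most half the number
of messages. -/
theorem eventually_cells_le {n : ℕ} (hn : 1 ≤ n) {M : ℝ≥0 → ℕ} (hM : ∀ s, 2 ≤ M s) {r : ℝ}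
    (hlim : Tendsto (fun s : ℝ≥0 => Real.log (M s) / n / Real.log s) atTop (nhds r))
    {e : ℝ} (he : 1 - r < e) {C : ℝ} (hC : 0 ≤ C) :
    ∀ᶠ s : ℝ≥0 in atTop,
      (2 * ⌊C * (s : ℝ) ^ ((1 - e) / 2) + 1 / 2⌋₊ + 1 : ℝ) ^ (2 * n) ≤ (M s : ℝ) / 2 := by
  have hn' : (0 : ℝ) < n := by exact_mod_cast hn
  -- If `e > 1` a single cell eventually remains, and two messages already suffice. At `r = 0` this
  -- is the only case, and `M s` may stay bounded.
  rcases lt_or_ge ((1 - e) / 2) 0 with hf | hf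
  · have h0 : Tendsto (fun s : ℝ≥0 => C * (s : ℝ) ^ ((1 - e) / 2)) atTop (nhds (C * 0)) := by
      have := (tendsto_rpow_neg_atTop (neg_pos.2 hf)).comp tendsto_coe_nnreal_atTop
      rw [neg_neg] at this
      exact this.const_mul C
    rw [mul_zero] at h0
    filter_upwards [h0.eventually_lt_const (show (0 : ℝ) < 1 / 2 by norm_num)] with s hs
    have : ⌊C * (s : ℝ) ^ ((1 - e) / 2) + 1 / 2⌋₊ = 0 := Nat.floor_eq_zero.2 (by linarith)
    rw [this]
    have h2 : (2 : ℝ) ≤ M s := by exact_mod_cast hM s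
    simp only [Nat.cast_zero, mul_zero, zero_add, one_pow]
    linarith
  · set f := (1 - e) / 2 with hf_def
    -- The gap between `2f = 1 - e` and `r'` absorbs the constants; the gap between `r'` and `r`
    -- turns the limit into the bound `s ^ (n * r') ≤ M s`.
    obtain ⟨r', hr1, hr2⟩ : ∃ r', 2 * f < r' ∧ r' < r := exists_between (by linarith)
    have hbig : Tendsto (fun s : ℝ≥0 => (s : ℝ) ^ (n * (r' - 2 * f))) atTop atTop :=
      (tendsto_rpow_atTop (mul_pos hn' (by linarith))).comp tendsto_coe_nnreal_atTop
    filter_upwards [hlim.eventually_const_lt hr2, eventually_one_lt_coe_nnreal,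
      hbig.eventually_ge_atTop (2 * (2 * C + 2) ^ (2 * n))] with s h1 h2 h3
    have hs0 : (0 : ℝ) < s := by linarith
    have hlog : 0 < Real.log s := Real.log_pos h2
    have hMpos : (0 : ℝ) < M s := by
      have := hM s
      exact_mod_cast (by omega : 0 < M s)
    have hMge : (s : ℝ) ^ (n * r') ≤ M s := by
      rw [lt_div_iff₀ hlog, lt_div_iff₀ hn'] at h1
      rw [Real.rpow_def_of_pos hs0, ← Real.le_log_iff_exp_le hMpos]
      linarith
    have hsf : (1 : ℝ) ≤ (s : ℝ) ^ f := Real.one_le_rpow h2.le hf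
    have hfl : (⌊C * (s : ℝ) ^ f + 1 / 2⌋₊ : ℝ) ≤ C * (s : ℝ) ^ f + 1 / 2 :=
      Nat.floor_le (by positivity)
    calc (2 * ⌊C * (s : ℝ) ^ f + 1 / 2⌋₊ + 1 : ℝ) ^ (2 * n)
        ≤ ((2 * C + 2) * (s : ℝ) ^ f) ^ (2 * n) := by
          refine pow_le_pow_left₀ (by positivity) ?_ _
          nlinarith
      _ = (2 * C + 2) ^ (2 * n) * (s : ℝ) ^ (n * (2 * f)) := by
          rw [mul_pow, ← Real.rpow_natCast ((s : ℝ) ^ f), ← Real.rpow_mul hs0.le]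
          congr 2; push_cast; ring
      _ ≤ (s : ℝ) ^ (n * (r' - 2 * f)) / 2 * (s : ℝ) ^ (n * (2 * f)) := by
          refine mul_le_mul_of_nonneg_right (by linarith) (by positivity)
      _ = (s : ℝ) ^ (n * r') / 2 := by
          rw [div_mul_eq_mul_div, ← Real.rpow_add hs0]; congr 2; ring
      _ ≤ _ := by linarith

/-- For every exponent beyond the outage exponent, the average error probability is eventually
bounded below by the corresponding power. -/
theorem exists_eventually_le_err {N ν Mr : ℕ} (hN : 1 ≤ N) (hMr : 1 ≤ Mr)
    {M : ℝ≥0 → ℕ} (hM : ∀ s, 2 ≤ M s) {r : ℝ} (hr : r ≤ 1)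
    (hlim : Tendsto (fun s : ℝ≥0 => Real.log (M s) / ((N : ℝ) + ν) / Real.log s) atTop (nhds r))
    {D : ℝ} (hD : (Mr : ℝ) * ((ν : ℝ) + 1) * (1 - r) < D) :
    ∃ c : ℝ, 0 < c ∧ ∀ᶠ s : ℝ≥0 in atTop, ∀ (I J : Type) [Fintype I] [Fintype J]
      [MeasurableSpace I] [MeasurableSingletonClass I] (x : I → J → Fin (N + ν) → ℂ)
      (dec : Taps ν Mr → Samples N ν Mr → I),
      Fintype.card I = M s →
      (∑ i, ∑ j, ∑ n, ‖x i j n‖ ^ 2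
        ≤ Fintype.card I * Fintype.card J * (((N : ℝ) + ν) * s)) →
      (Measurable fun q : Taps ν Mr × Samples N ν Mr => dec q.1 q.2) →
      c * (s : ℝ) ^ (-D) * (Fintype.card I * Fintype.card J) ≤
        ∑ i, ∑ j, (channelLaw N ν Mr).real {q | dec q.1 (received q.1 (x i j) q.2) ≠ i} := by
  obtain ⟨b, hb0, hb⟩ := exists_iidGaussian_shift_le (N + ν) Mr
  obtain ⟨c, hc, hball⟩ := exists_le_stdComplexGaussian_closedBall
  have hk : (0 : ℝ) < (Mr : ℝ) * ((ν : ℝ) + 1) := by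
    have : (1 : ℝ) ≤ Mr := by exact_mod_cast hMr
    positivity
  -- `e` is the exponent per tap: the event `‖h‖ ≤ s ^ (-e / 2)` has probability of order `s ^
  -- (-D)`.
  set e : ℝ := D / ((Mr : ℝ) * ((ν : ℝ) + 1)) with he_def
  have he : 1 - r < e := by rw [he_def, lt_div_iff₀ hk]; linarith
  have hDe : D = (Mr : ℝ) * ((ν : ℝ) + 1) * e := by rw [he_def]; field_simp
  have he0 : 0 < e := by linarith
  have hnn : (0 : ℝ) < (N : ℝ) + ν := by
    have : (1 : ℝ) ≤ N := by exact_mod_cast hN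
    positivity
  have hcells := eventually_cells_le (n := N + ν) (by omega) hM (r := r)
    (by push_cast; exact hlim) he
    (C := √(10 * ((N : ℝ) + ν)) * (ν + 1) / b) (by positivity)
  refine ⟨3 / 10 * c ^ (Mr * (ν + 1)), by positivity, ?_⟩
  filter_upwards [hcells, eventually_one_lt_coe_nnreal] with s hs hs1
  intro I J _ _ _ _ x dec hcard hx hdec
  have hs0 : (0 : ℝ) < s := by linarith
  set t : ℝ := (s : ℝ) ^ (-e / 2) with ht_def
  have ht : 0 < t := Real.rpow_pos_of_pos hs0 _
  have ht1 : t ≤ 1 := Real.rpow_le_one_of_one_le_of_nonpos hs1.le (by linarith)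
  have harg : √(10 * (((N : ℝ) + ν) * s)) * (ν + 1) * t / b
      = √(10 * ((N : ℝ) + ν)) * (ν + 1) / b * (s : ℝ) ^ ((1 - e) / 2) := by
    rw [← mul_assoc, Real.sqrt_mul (by positivity), Real.sqrt_eq_rpow (s : ℝ), ht_def]
    have : (s : ℝ) ^ ((1 - e) / 2) = (s : ℝ) ^ (1 / 2 : ℝ) * (s : ℝ) ^ (-e / 2) := by
      rw [← Real.rpow_add hs0]; congr 1; ring
    rw [this]; ring
  have hout := outage_le_sum_err hb0 hb x (s := ((N : ℝ) + ν) * s) (t := t) (by positivity) ht hx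
    hdec (by rw [harg, hcard]; exact hs)
  refine le_trans (le_of_le_of_eq ?_ (mul_right_comm _ _ _)) hout
  refine mul_le_mul_of_nonneg_right ?_ (by positivity)
  rw [mul_assoc]
  refine mul_le_mul_of_nonneg_left ?_ (by norm_num)
  have hst : (s : ℝ) ^ (-D) = (t ^ 2) ^ (Mr * (ν + 1)) := by
    rw [ht_def, ← Real.rpow_natCast, ← Real.rpow_natCast, ← Real.rpow_mul hs0.le,
      ← Real.rpow_mul hs0.le, hDe]
    congr 1; push_cast; ring
  rw [hst, ← mul_pow]
  refine pow_le_pow_left₀ (by positivity) ?_ _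
  rw [measureReal_def, ← ENNReal.toReal_ofReal (show 0 ≤ c * t ^ 2 by positivity)]
  exact ENNReal.toReal_mono (measure_ne_top _ _) (hball t ht.le ht1)

/-! ### The converse for two-stream codes -/

theorem TwoStreamCode.sum_energy_le {N ν Mr : ℕ} (hN : 1 ≤ N) {snr : ℝ≥0}
    (C : TwoStreamCode N ν Mr snr) :
    ∑ i, ∑ j, ∑ n, ‖C.enc i j n‖ ^ 2 ≤ (C.numH : ℝ) * C.numL * (((N : ℝ) + ν) * snr) := by
  have hH : (2 : ℝ) ≤ C.numH := by exact_mod_cast C.two_le_numH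
  have hL : (2 : ℝ) ≤ C.numL := by exact_mod_cast C.two_le_numL
  have hn : (1 : ℝ) ≤ N := by exact_mod_cast hN
  have := (div_le_iff₀ (by positivity)).1 C.power_le
  linarith

/-- A positive limit of `-log err / log snr` forces polynomial decay of `err`. -/
theorem eventually_lt_rpow_of_tendsto {err : ℝ≥0 → ℝ} {d D : ℝ} (herr : ∀ s, 0 ≤ err s)
    (hlim : Tendsto (fun s : ℝ≥0 => -Real.log (err s) / Real.log s) atTop (nhds d))
    (hD : D < d) : ∀ᶠ s : ℝ≥0 in atTop, err s < (s : ℝ) ^ (-D) := by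
  filter_upwards [hlim.eventually_const_lt hD, eventually_one_lt_coe_nnreal] with s h1 h2
  have hs0 : (0 : ℝ) < s := by linarith
  -- Since `Real.log 0 = 0`, the hypothesis says nothing about the size of a vanishing error; there
  -- the bound is immediate.
  rcases (herr s).eq_or_lt with h0 | hpos
  · rw [← h0]; exact Real.rpow_pos_of_pos hs0 _
  · rw [lt_div_iff₀ (Real.log_pos h2)] at h1
    rw [Real.rpow_def_of_pos hs0, ← Real.log_lt_iff_lt_exp hpos]
    linarith

theorem not_eventually_le_rpow {err : ℝ≥0 → ℝ} {D D' c K : ℝ} (hc : 0 < c) (hDD : D < D')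
    (h1 : ∀ᶠ s : ℝ≥0 in atTop, c * (s : ℝ) ^ (-D) ≤ err s)
    (h2 : ∀ᶠ s : ℝ≥0 in atTop, err s ≤ K * (s : ℝ) ^ (-D')) : False := by
  have hbig : Tendsto (fun s : ℝ≥0 => (s : ℝ) ^ (D' - D)) atTop atTop :=
    (tendsto_rpow_atTop (by linarith)).comp tendsto_coe_nnreal_atTop
  obtain ⟨s, h1, h2, h3, h4⟩ := (h1.and (h2.and (eventually_one_lt_coe_nnreal.and
    (hbig.eventually_gt_atTop (K / c))))).exists
  have hs0 : (0 : ℝ) < s := by linarith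
  have : c * (s : ℝ) ^ (-D) = c * (s : ℝ) ^ (D' - D) * (s : ℝ) ^ (-D') := by
    rw [mul_assoc, ← Real.rpow_add hs0]; congr 2; ring
  rw [this] at h1
  have h5 := le_of_mul_le_mul_right (h1.trans h2) (Real.rpow_pos_of_pos hs0 _)
  rw [div_lt_iff₀ hc] at h4
  linarith

namespace TwoStreamCode

variable {N ν Mr : ℕ} {snr : ℝ≥0} (C : TwoStreamCode N ν Mr snr)

theorem errH_nonneg : 0 ≤ C.errH := by unfold errH; positivity

theorem errL_nonneg : 0 ≤ C.errL := by unfold errL; positivity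

theorem numH_mul_numL_pos : (0 : ℝ) < (C.numH : ℝ) * C.numL := by
  have hH : (2 : ℝ) ≤ C.numH := by exact_mod_cast C.two_le_numH
  have hL : (2 : ℝ) ≤ C.numL := by exact_mod_cast C.two_le_numL
  positivity

/-- The joint message is decoded wrongly only if one of the two messages is. -/
theorem sum_joint_err_le :
    ∑ i : Fin C.numH × Fin C.numL, ∑ _j : Unit, (channelLaw N ν Mr).real
      {q | ((C.decH q.1 (received q.1 (C.enc i.1 i.2) q.2),
        C.decL q.1 (received q.1 (C.enc i.1 i.2) q.2)) : Fin C.numH × Fin C.numL) ≠ i}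
      ≤ (C.errH + C.errL) * ((C.numH : ℝ) * C.numL) := by
  rw [errH, errL, ← add_div, div_mul_cancel₀ _ C.numH_mul_numL_pos.ne',
    Fintype.sum_prod_type, ← Finset.sum_add_distrib]
  refine Finset.sum_le_sum fun i _ => ?_
  rw [← Finset.sum_add_distrib]
  refine Finset.sum_le_sum fun j _ => ?_
  simp only [Finset.univ_unique, Finset.sum_const, Finset.card_singleton, one_smul]
  refine le_trans (measureReal_mono ?_) (measureReal_union_le _ _)
  intro q hq
  by_contra hcon
  simp only [Set.mem_union, Set.mem_ofPred_eq, not_or, not_not] at hcon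
  exact hq (Prod.ext hcon.1 hcon.2)

end TwoStreamCode

/-- The converse: the outage bound on the diversity orders of both streams. -/
theorem Achievable.le_outage {N ν Mr : ℕ} (hN : 1 ≤ N) (hMr : 1 ≤ Mr) {rH rL dH dL : ℝ}
    (hrL : 0 ≤ rL) (hr : rH + rL ≤ 1) (h : Achievable N ν Mr rH dH rL dL) :
    dH ≤ (Mr : ℝ) * ((ν : ℝ) + 1) * (1 - rH) ∧
      dL ≤ (Mr : ℝ) * ((ν : ℝ) + 1) * (1 - (rH + rL)) := by
  obtain ⟨hd, C, hRH, hRL, hEH, hEL⟩ := h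
  constructor
  · by_contra! hlt
    obtain ⟨D, hD1, hD2⟩ := exists_between hlt
    obtain ⟨D', hD1', hD2'⟩ := exists_between hD2
    obtain ⟨c, hc, hev⟩ := exists_eventually_le_err hN hMr (M := fun s => (C s).numH)
      (fun s => (C s).two_le_numH) (by linarith) hRH hD1
    refine not_eventually_le_rpow hc hD1' (err := fun s => (C s).errH) (K := 1) ?_ ?_
    · filter_upwards [hev] with s hs
      have := hs (Fin (C s).numH) (Fin (C s).numL) (C s).enc (C s).decH (Fintype.card_fin _)
        (by simpa using (C s).sum_energy_le hN) (C s).measurable_decH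
      rw [Fintype.card_fin, Fintype.card_fin] at this
      exact (le_div_iff₀ (C s).numH_mul_numL_pos).2 this
    · filter_upwards [eventually_lt_rpow_of_tendsto (fun s => (C s).errH_nonneg) hEH hD2']
        with s hs
      rw [one_mul]; exact hs.le
  · by_contra! hlt
    obtain ⟨D, hD1, hD2⟩ := exists_between hlt
    obtain ⟨D', hD1', hD2'⟩ := exists_between hD2
    have hlim : Tendsto (fun s : ℝ≥0 => Real.log (((C s).numH * (C s).numL : ℕ) : ℝ)
        / ((N : ℝ) + ν) / Real.log s) atTop (nhds (rH + rL)) := by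
      refine (hRH.add hRL).congr fun s => ?_
      have hH : ((C s).numH : ℝ) ≠ 0 := by
        have := (C s).two_le_numH
        exact_mod_cast (by omega : (C s).numH ≠ 0)
      have hL : ((C s).numL : ℝ) ≠ 0 := by
        have := (C s).two_le_numL
        exact_mod_cast (by omega : (C s).numL ≠ 0)
      rw [Nat.cast_mul, Real.log_mul hH hL, TwoStreamCode.rateH, TwoStreamCode.rateL]
      ring
    obtain ⟨c, hc, hev⟩ := exists_eventually_le_err hN hMr
      (M := fun s => (C s).numH * (C s).numL)
      (fun s => by nlinarith [(C s).two_le_numH, (C s).two_le_numL]) hr hlim hD1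
    -- The outage bound is applied to the pair as a single message, with a trivial second stream.
    -- Since `D' < dL ≤ dH`, both error terms lie below `s ^ (-D')`.
    refine not_eventually_le_rpow hc hD1' (err := fun s => (C s).errH + (C s).errL)
      (K := 2) ?_ ?_
    · filter_upwards [hev] with s hs
      have := hs (Fin (C s).numH × Fin (C s).numL) Unit (fun i _ => (C s).enc i.1 i.2)
        (fun h y => ((C s).decH h y, (C s).decL h y)) (by simp)
        (by
          rw [Fintype.sum_prod_type]
          simpa using (C s).sum_energy_le hN)
        ((C s).measurable_decH.prodMk (C s).measurable_decL)
      rw [Fintype.card_prod, Fintype.card_fin, Fintype.card_fin, Fintype.card_unit] at this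
      have h2 := this.trans (C s).sum_joint_err_le
      rw [Nat.cast_one, mul_one, Nat.cast_mul] at h2
      exact le_of_mul_le_mul_right h2 (C s).numH_mul_numL_pos
    · filter_upwards [eventually_lt_rpow_of_tendsto (fun s => (C s).errH_nonneg) hEH
          (hD2'.trans_le hd),
        eventually_lt_rpow_of_tendsto (fun s => (C s).errL_nonneg) hEL hD2'] with s h1 h2
      linarith

/-! ### Injectivity of convolution with a guard interval -/

theorem received_smul {N ν Mr : ℕ} (a b : ℂ) (h : Taps ν Mr) (x : Fin (N + ν) → ℂ) :
    (received (a • h) (b • x) 0 : Samples N ν Mr) = (a * b) • received h x 0 := by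
  funext n p
  simp only [received, Pi.smul_apply, Pi.zero_apply, add_zero, smul_eq_mul, Finset.mul_sum]
  refine Finset.sum_congr rfl fun m _ => ?_
  split_ifs <;> ring

/-- As for products of polynomials, the first nonzero tap on some antenna meets the first nonzero
symbol in a single surviving term. The guard interval keeps that output index inside the block. -/
theorem received_ne_zero {N ν Mr : ℕ} {h : Taps ν Mr} {x : Fin (N + ν) → ℂ}
    (hh : h ≠ 0) (hx : x ≠ 0) (hguard : ∀ n : Fin (N + ν), N ≤ (n : ℕ) → x n = 0) :
    (received h x 0 : Samples N ν Mr) ≠ 0 := by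
  classical
  obtain ⟨m₁, hm₁⟩ := Function.ne_iff.1 hh
  obtain ⟨p, hp⟩ := Function.ne_iff.1 hm₁
  obtain ⟨k₁, hk₁⟩ := Function.ne_iff.1 hx
  obtain ⟨m₀, hm₀, hmin⟩ := WellFounded.has_min (wellFounded_lt (α := Fin (ν + 1)))
    {m | h m p ≠ 0} ⟨m₁, hp⟩
  obtain ⟨k₀, hk₀, hkmin⟩ := WellFounded.has_min (wellFounded_lt (α := Fin (N + ν)))
    {k | x k ≠ 0} ⟨k₁, hk₁⟩
  have hkN : (k₀ : ℕ) < N := by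
    by_contra! hcon
    exact hk₀ (hguard k₀ hcon)
  have hlt : (m₀ : ℕ) + k₀ < N + ν := by have := m₀.isLt; omega
  intro h0
  have hval := congrFun (congrFun h0 ⟨m₀ + k₀, hlt⟩) p
  simp only [received, Pi.zero_apply, add_zero] at hval
  rw [Finset.sum_eq_single m₀] at hval
  · rw [if_pos (by simp)] at hval
    have hidx : (⟨(m₀ : ℕ) + k₀ - m₀, lt_of_le_of_lt (Nat.sub_le _ _) hlt⟩ : Fin (N + ν)) = k₀ :=
      Fin.ext (by simp)
    rw [hidx] at hval
    exact (mul_ne_zero hm₀ hk₀) hval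
  · intro m _ hm
    rcases lt_or_gt_of_ne hm with hlt' | hgt
    · have : h m p = 0 := by
        by_contra hne
        exact hmin m hne hlt'
      rw [this, zero_mul]
    · split_ifs with hle
      · have : x ⟨(m₀ : ℕ) + k₀ - m, lt_of_le_of_lt (Nat.sub_le _ _) hlt⟩ = 0 := by
          by_contra hne
          refine hkmin _ hne ?_
          rw [Fin.lt_def] at hgt ⊢
          simp only at hle ⊢
          omega
        rw [this, mul_zero]
      · rw [mul_zero]
  · simp

/-- With a guard interval, the channel does not attenuate codewords by more than a constant times
the norm of the taps. -/
theorem exists_mul_norm_le_norm_received (N ν Mr : ℕ) :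
    ∃ c : ℝ, 0 < c ∧ ∀ (h : Taps ν Mr) (x : Fin (N + ν) → ℂ),
      (∀ n : Fin (N + ν), N ≤ (n : ℕ) → x n = 0) →
      c * ‖h‖ * ‖x‖ ≤ ‖(received h x 0 : Samples N ν Mr)‖ := by
  set S : Set (Taps ν Mr × (Fin (N + ν) → ℂ)) :=
    Metric.sphere 0 1 ×ˢ (Metric.sphere 0 1 ∩ {x | ∀ n : Fin (N + ν), N ≤ (n : ℕ) → x n = 0})
  -- Homogeneity in each argument reduces the bound to unit vectors, where a positive continuous
  -- function on a compact set is bounded away from zero.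
  have hS : IsCompact S := by
    refine (isCompact_sphere 0 1).prod ((isCompact_sphere 0 1).inter_right ?_)
    simp only [Set.ofPred_forall]
    exact isClosed_iInter fun n => isClosed_iInter fun _ =>
      isClosed_eq (continuous_apply n) continuous_const
  have hcont : Continuous fun q : Taps ν Mr × (Fin (N + ν) → ℂ) =>
      ‖(received q.1 q.2 0 : Samples N ν Mr)‖ := by
    refine continuous_norm.comp (continuous_pi fun n => continuous_pi fun p => ?_)
    unfold received
    refine Continuous.add (continuous_finsetSum _ fun m _ => ?_) continuous_const
    by_cases hle : (m : ℕ) ≤ n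
    · simp only [hle, if_true]; fun_prop
    · simp only [hle, if_false]; fun_prop
  obtain ⟨c, hc, hmin⟩ := hS.exists_forall_le' hcont.continuousOn (a := 0) (by
    rintro ⟨h, x⟩ ⟨hh, hx, hg⟩
    refine norm_pos_iff.2 (received_ne_zero ?_ ?_ hg)
    · exact ne_zero_of_mem_unit_sphere ⟨h, hh⟩
    · exact ne_zero_of_mem_unit_sphere ⟨x, hx⟩)
  refine ⟨c, hc, fun h x hg => ?_⟩
  rcases eq_or_ne h 0 with rfl | hh
  · simp
  rcases eq_or_ne x 0 with rfl | hx
  · simp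
  have hh' : 0 < ‖h‖ := norm_pos_iff.2 hh
  have hx' : 0 < ‖x‖ := norm_pos_iff.2 hx
  have hnorm : ∀ {E : Type} [NormedAddCommGroup E] [NormedSpace ℂ E] (v : E), 0 < ‖v‖ →
      ‖((‖v‖ : ℂ)⁻¹ • v)‖ = 1 := by
    intro E _ _ v hv
    rw [norm_smul, norm_inv, Complex.norm_real, norm_norm, inv_mul_cancel₀ hv.ne']
  have := hmin ((‖h‖ : ℂ)⁻¹ • h, (‖x‖ : ℂ)⁻¹ • x) ⟨mem_sphere_zero_iff_norm.2 (hnorm h hh'),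
    mem_sphere_zero_iff_norm.2 (hnorm x hx'), fun n hn => by simp [hg n hn]⟩
  rw [received_smul, norm_smul, norm_mul, norm_inv, norm_inv, Complex.norm_real, Complex.norm_real,
    norm_norm, norm_norm, ← mul_inv, inv_mul_eq_div, le_div_iff₀ (by positivity)] at this
  linarith

/-! ### Minimum distance decoding -/

/-- Candidates are added one at a time. The induction also carries measurability of the current
minimum, which the comparison with the next candidate requires. -/
theorem exists_measurable_argmin {Ω ι : Type*} [MeasurableSpace Ω] [Fintype ι] [Nonempty ι]
    [MeasurableSpace ι] {f : ι → Ω → ℝ} (hf : ∀ i, Measurable (f i)) :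
    ∃ d : Ω → ι, Measurable d ∧ ∀ ω i, f (d ω) ω ≤ f i ω := by
  classical
  suffices H : ∀ s : Finset ι, ∃ d : Ω → ι, Measurable d ∧ (Measurable fun ω => f (d ω) ω) ∧
      ∀ ω, ∀ i ∈ s, f (d ω) ω ≤ f i ω by
    obtain ⟨d, hd, -, h⟩ := H Finset.univ
    exact ⟨d, hd, fun ω i => h ω i (Finset.mem_univ i)⟩
  intro s
  induction s using Finset.induction_on with
  | empty => exact ⟨fun _ => Classical.arbitrary ι, measurable_const, hf _, by simp⟩
  | insert a s _ ih =>
    obtain ⟨d, hd, hfd, h⟩ := ih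
    have hm : MeasurableSet {ω | f a ω ≤ f (d ω) ω} := measurableSet_le (hf a) hfd
    refine ⟨fun ω => if f a ω ≤ f (d ω) ω then a else d ω, Measurable.ite hm measurable_const hd,
      ?_, fun ω i hi => ?_⟩
    · have : (fun ω => f (if f a ω ≤ f (d ω) ω then a else d ω) ω)
          = fun ω => if f a ω ≤ f (d ω) ω then f a ω else f (d ω) ω := by
        funext ω; split_ifs <;> rfl
      rw [this]
      exact Measurable.ite hm (hf a) hfd
    · rw [Finset.mem_insert] at hi
      dsimp only
      split_ifs with hle
      · rcases hi with rfl | hi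
        · exact le_rfl
        · exact hle.trans (h ω i hi)
      · rcases hi with rfl | hi
        · exact (not_le.1 hle).le
        · exact h ω i hi

theorem measurable_norm_sub_received {N ν Mr : ℕ} (x : Fin (N + ν) → ℂ) :
    Measurable fun q : Taps ν Mr × Samples N ν Mr => ‖q.2 - received q.1 x 0‖ := by
  have : Measurable fun q : Taps ν Mr × Samples N ν Mr => (received q.1 x 0 : Samples N ν Mr) := by
    unfold received; fun_prop
  fun_prop

/-- The received block is at distance `‖z‖` from the true noiseless output and no farther from the
competing one, so the two outputs are within `2‖z‖`. -/
theorem norm_received_sub_le {N ν Mr : ℕ} {h : Taps ν Mr} {x x' : Fin (N + ν) → ℂ}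
    {z : Samples N ν Mr}
    (hmin : ‖received h x z - received h x' 0‖ ≤ ‖received h x z - received h x 0‖) :
    ‖(received h (x - x') 0 : Samples N ν Mr)‖ ≤ 2 * ‖z‖ := by
  rw [received_eq_add h x z, add_sub_cancel_left] at hmin
  have h1 : (received h (x - x') 0 : Samples N ν Mr)
      = (received h x 0 + z - received h x' 0) - z := by
    rw [← received_sub]; abel
  rw [h1]
  refine (norm_sub_le _ _).trans ?_
  linarith

/-! ### Probabilities of the bad events -/

/-- Large noise or weak taps. -/
def badEvent (N ν Mr : ℕ) (τ η : ℝ) : Set (Taps ν Mr × Samples N ν Mr) :=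
  {q | τ ≤ ‖q.2‖} ∪ {q | ‖q.1‖ ≤ η}

theorem channelLaw_badEvent_le (N ν Mr : ℕ) {τ η : ℝ} (hτ : 0 < τ) (hη : 0 ≤ η) :
    (channelLaw N ν Mr).real (badEvent N ν Mr τ η)
      ≤ (N + ν : ℕ) * Mr * 4 * Real.exp (-τ ^ 2 / 4) + (4 * η ^ 2) ^ (Mr * (ν + 1)) := by
  refine (measureReal_union_le _ _).trans (add_le_add ?_ ?_)
  · have hset : {q : Taps ν Mr × Samples N ν Mr | τ ≤ ‖q.2‖}
        = Set.univ ×ˢ {z : Samples N ν Mr | τ ≤ ‖z‖} := by ext; simp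
    rw [hset, measureReal_def, channelLaw, Measure.prod_prod, measure_univ, one_mul,
      ← ENNReal.toReal_ofReal (r := (N + ν : ℕ) * Mr * 4 * Real.exp (-τ ^ 2 / 4)) (by positivity)]
    exact ENNReal.toReal_mono ENNReal.ofReal_ne_top (iidGaussian_norm_ge_le _ _ hτ)
  · have hset : {q : Taps ν Mr × Samples N ν Mr | ‖q.1‖ ≤ η}
        = {h : Taps ν Mr | ‖h‖ ≤ η} ×ˢ Set.univ := by ext; simp
    rw [hset, measureReal_def, channelLaw, Measure.prod_prod, measure_univ, mul_one,
      iidGaussian_closedBall _ _ hη, ENNReal.toReal_pow]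
    refine pow_le_pow_left₀ ENNReal.toReal_nonneg ?_ _
    rw [← ENNReal.toReal_ofReal (r := 4 * η ^ 2) (by positivity)]
    exact ENNReal.toReal_mono ENNReal.ofReal_ne_top (stdComplexGaussian_closedBall_le hη)

theorem channelLaw_tap_norm_le {N ν Mr : ℕ} (m : Fin (ν + 1)) (p : Fin Mr) (t : ℝ) :
    (channelLaw N ν Mr).real {q | ‖q.1 m p‖ ≤ t}
      = stdComplexGaussian.real (Metric.closedBall 0 t) := by
  have hmp : MeasurePreserving (fun q : Taps ν Mr × Samples N ν Mr => q.1 m p)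
      (channelLaw N ν Mr) stdComplexGaussian :=
    ((measurePreserving_eval (fun _ : Fin Mr => stdComplexGaussian) p).comp
      (measurePreserving_eval
        (fun _ : Fin (ν + 1) => Measure.pi fun _ : Fin Mr => stdComplexGaussian) m)).comp
      measurePreserving_fst
  rw [measureReal_def, measureReal_def,
    ← hmp.measure_preimage Metric.isClosed_closedBall.measurableSet.nullMeasurableSet]
  congr 2
  ext q
  simp

/-! ### The nested grid code -/

/-- The codeword of a pair of digit arrays: a coarse grid with `mH` levels per real dimension,
refined by `mL` levels, followed by a guard interval of zeros. -/
noncomputable def gridCodeword (N ν : ℕ) {mH mL : ℕ} (w : ℝ)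
    (A : Fin N → Fin 2 → Fin mH) (B : Fin N → Fin 2 → Fin mL) : Fin (N + ν) → ℂ := fun n =>
  if hn : (n : ℕ) < N then
    ⟨w * (2 * mL * (A ⟨n, hn⟩ 0 : ℕ) + (B ⟨n, hn⟩ 0 : ℕ)),
      w * (2 * mL * (A ⟨n, hn⟩ 1 : ℕ) + (B ⟨n, hn⟩ 1 : ℕ))⟩
  else 0

theorem gridCodeword_guard {N ν mH mL : ℕ} (w : ℝ) (A : Fin N → Fin 2 → Fin mH)
    (B : Fin N → Fin 2 → Fin mL) {n : Fin (N + ν)} (hn : N ≤ (n : ℕ)) :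
    gridCodeword N ν w A B n = 0 := by
  simp [gridCodeword, not_lt.2 hn]

theorem sq_norm_gridCodeword_le {N ν mH mL : ℕ} {w : ℝ} (hw : 0 ≤ w)
    (A : Fin N → Fin 2 → Fin mH) (B : Fin N → Fin 2 → Fin mL) (n : Fin (N + ν)) :
    ‖gridCodeword N ν w A B n‖ ^ 2 ≤ (4 * w * mH * mL) ^ 2 := by
  unfold gridCodeword
  split_ifs with hn
  · have hdig : ∀ k, w * (2 * mL * (A ⟨n, hn⟩ k : ℕ) + (B ⟨n, hn⟩ k : ℕ)) ≤ 2 * w * mH * mL := by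
      intro k
      have h1 : ((A ⟨n, hn⟩ k : ℕ) : ℝ) + 1 ≤ mH := by exact_mod_cast (A ⟨n, hn⟩ k).isLt
      have h2 : ((B ⟨n, hn⟩ k : ℕ) : ℝ) + 1 ≤ mL := by exact_mod_cast (B ⟨n, hn⟩ k).isLt
      have h3 : (2 * mL * (A ⟨n, hn⟩ k : ℕ) + (B ⟨n, hn⟩ k : ℕ) : ℝ) ≤ 2 * (mH * mL) := by
        nlinarith
      nlinarith
    refine pow_le_pow_left₀ (norm_nonneg _) ?_ 2
    refine (Complex.norm_le_abs_re_add_abs_im _).trans ?_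
    simp only
    rw [abs_of_nonneg (by positivity), abs_of_nonneg (by positivity)]
    linarith [hdig 0, hdig 1]
  · rw [norm_zero, zero_pow two_ne_zero]
    exact sq_nonneg _

theorem le_norm_gridCodeword_sub {N ν mH mL : ℕ} {w δ : ℝ} (hw : 0 ≤ w)
    {A A' : Fin N → Fin 2 → Fin mH} {B B' : Fin N → Fin 2 → Fin mL} (n : Fin N) (k : Fin 2)
    (hδ : δ ≤ |(2 * mL * (A n k : ℕ) + (B n k : ℕ) : ℝ)
      - (2 * mL * (A' n k : ℕ) + (B' n k : ℕ))|) :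
    w * δ ≤ ‖gridCodeword N ν w A B - gridCodeword N ν w A' B'‖ := by
  refine le_trans ?_ (norm_le_pi_norm _ (Fin.castAdd ν n))
  have h1 : w * δ ≤ |w * (2 * mL * (A n k : ℕ) + (B n k : ℕ))
      - w * (2 * mL * (A' n k : ℕ) + (B' n k : ℕ))| := by
    rw [← mul_sub, abs_mul, abs_of_nonneg hw]
    exact mul_le_mul_of_nonneg_left hδ hw
  refine h1.trans ?_
  have hn : ((Fin.castAdd ν n : Fin (N + ν)) : ℕ) < N := n.isLt
  rw [Pi.sub_apply, gridCodeword, gridCodeword, dif_pos hn, dif_pos hn]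
  obtain rfl | rfl : k = 0 ∨ k = 1 := by omega
  · refine le_trans (le_of_eq ?_) (Complex.abs_re_le_norm _)
    rw [Complex.sub_re]
    rfl
  · refine le_trans (le_of_eq ?_) (Complex.abs_im_le_norm _)
    rw [Complex.sub_im]
    rfl

/-- Coarse steps have length `2m` and fine digits differ by less than `m`, so a gap of `m` survives.
This is why the coarse digit carries a factor two. -/
theorem le_abs_digits_sub {m : ℕ} {a a' : ℕ} {b b' : ℕ} (hb : b < m) (hb' : b' < m)
    (ha : a ≠ a') : (m : ℝ) ≤ |(2 * m * a + b : ℝ) - (2 * m * a' + b')| := by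
  have hZ : (m : ℤ) ≤ |(2 * m * a + b : ℤ) - (2 * m * a' + b')| := by
    rcases lt_or_gt_of_ne ha with h | h
    · refine le_trans ?_ (neg_le_abs _)
      have : (m : ℤ) * (a' - a) ≥ m * 1 := by gcongr; omega
      nlinarith
    · refine le_trans ?_ (le_abs_self _)
      have : (m : ℤ) * (a - a') ≥ m * 1 := by gcongr; omega
      nlinarith
  exact_mod_cast hZ

/-- The fine digits are arbitrary on both sides, so the refinement cannot erode the separation of
high priority messages. -/
theorem mul_le_norm_gridCodeword_sub {N ν mH mL : ℕ} {w : ℝ} (hw : 0 ≤ w)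
    {A A' : Fin N → Fin 2 → Fin mH} (B B' : Fin N → Fin 2 → Fin mL) (hA : A ≠ A') :
    w * mL ≤ ‖gridCodeword N ν w A B - gridCodeword N ν w A' B'‖ := by
  obtain ⟨n, hn⟩ := Function.ne_iff.1 hA
  obtain ⟨k, hk⟩ := Function.ne_iff.1 hn
  exact le_norm_gridCodeword_sub hw n k
    (le_abs_digits_sub (B n k).isLt (B' n k).isLt fun h => hk (Fin.ext h))

theorem le_norm_gridCodeword_sub_of_ne {N ν mH mL : ℕ} {w : ℝ} (hw : 0 ≤ w) (hmL : 1 ≤ mL)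
    (A A' : Fin N → Fin 2 → Fin mH) {B B' : Fin N → Fin 2 → Fin mL} (hB : B ≠ B') :
    w ≤ ‖gridCodeword N ν w A B - gridCodeword N ν w A' B'‖ := by
  by_cases hA : A = A'
  · subst hA
    obtain ⟨n, hn⟩ := Function.ne_iff.1 hB
    obtain ⟨k, hk⟩ := Function.ne_iff.1 hn
    have hne : ((B n k : ℕ) : ℤ) - (B' n k : ℕ) ≠ 0 := by
      intro h
      exact hk (Fin.ext (by omega))
    have h1 : (1 : ℝ) ≤ |((B n k : ℕ) : ℝ) - (B' n k : ℕ)| := by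
      exact_mod_cast Int.one_le_abs hne
    rw [← add_sub_add_left_eq_sub _ _ (2 * mL * (A n k : ℕ) : ℝ)] at h1
    exact (mul_one w).ge.trans (le_norm_gridCodeword_sub hw n k h1)
  · refine le_trans ?_ (mul_le_norm_gridCodeword_sub hw B B' hA)
    exact le_mul_of_one_le_right hw (by exact_mod_cast hmL)

theorem average_le {a b : ℕ} (ha : 2 ≤ a) (hb : 2 ≤ b) {f : Fin a → Fin b → ℝ} {U : ℝ}
    (h : ∀ i j, f i j ≤ U) : (∑ i, ∑ j, f i j) / ((a : ℝ) * b) ≤ U := by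
  have ha' : (2 : ℝ) ≤ a := by exact_mod_cast ha
  have hb' : (2 : ℝ) ≤ b := by exact_mod_cast hb
  rw [div_le_iff₀ (by positivity)]
  calc ∑ i, ∑ j, f i j ≤ ∑ _i : Fin a, ∑ _j : Fin b, U :=
        Finset.sum_le_sum fun i _ => Finset.sum_le_sum fun j _ => h i j
    _ = U * ((a : ℝ) * b) := by simp; ring

/-- A decoder falling back on a fixed `i₀` is wrong for every other message, a fraction `(a - 1) / a
≥ 1/2`. -/
theorem half_le_average {a b : ℕ} (ha : 2 ≤ a) (hb : 2 ≤ b) {f : Fin a → Fin b → ℝ} {L : ℝ}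
    (hL : 0 ≤ L) (i₀ : Fin a) (h0 : ∀ i j, 0 ≤ f i j) (h : ∀ i j, i ≠ i₀ → L ≤ f i j) :
    L / 2 ≤ (∑ i, ∑ j, f i j) / ((a : ℝ) * b) := by
  have ha' : (2 : ℝ) ≤ a := by exact_mod_cast ha
  have hb' : (2 : ℝ) ≤ b := by exact_mod_cast hb
  rw [le_div_iff₀ (by positivity)]
  calc L / 2 * ((a : ℝ) * b) ≤ ((a : ℝ) - 1) * (b * L) := by
        have : 0 ≤ (b : ℝ) * L := by positivity
        nlinarith
    _ = ∑ i ∈ Finset.univ.erase i₀, ∑ _j : Fin b, L := by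
        simp only [Finset.sum_const, Finset.card_univ, Fintype.card_fin, nsmul_eq_mul,
          Finset.card_erase_of_mem (Finset.mem_univ i₀)]
        rw [Nat.cast_sub (by omega), Nat.cast_one]
    _ ≤ ∑ i ∈ Finset.univ.erase i₀, ∑ j, f i j :=
        Finset.sum_le_sum fun i hi => Finset.sum_le_sum fun j _ =>
          h i j (Finset.ne_of_mem_erase hi)
    _ ≤ ∑ i, ∑ j, f i j :=
        Finset.sum_le_sum_of_subset_of_nonneg (Finset.subset_univ _)
          fun i _ _ => Finset.sum_nonneg fun j _ => h0 i j

/-- A minimum distance decoding error between codewords at distance `Δ` requires large noise or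
weak taps. -/
theorem mem_badEvent_of_confusion {N ν Mr : ℕ} {c : ℝ} (hc : 0 < c)
    (hconv : ∀ (h : Taps ν Mr) (x : Fin (N + ν) → ℂ),
      (∀ n : Fin (N + ν), N ≤ (n : ℕ) → x n = 0) →
      c * ‖h‖ * ‖x‖ ≤ ‖(received h x 0 : Samples N ν Mr)‖)
    {x x' : Fin (N + ν) → ℂ} (hx : ∀ n : Fin (N + ν), N ≤ (n : ℕ) → x n = 0)
    (hx' : ∀ n : Fin (N + ν), N ≤ (n : ℕ) → x' n = 0) {Δ τ : ℝ} (hΔ : 0 < Δ)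
    (hxx : Δ ≤ ‖x - x'‖) {q : Taps ν Mr × Samples N ν Mr}
    (hmin : ‖received q.1 x q.2 - received q.1 x' 0‖ ≤ ‖received q.1 x q.2 - received q.1 x 0‖) :
    q ∈ badEvent N ν Mr τ (2 * τ / (c * Δ)) := by
  by_contra hcon
  simp only [badEvent, Set.mem_union, Set.mem_ofPred_eq, not_or, not_le] at hcon
  obtain ⟨h1, h2⟩ := hcon
  have h3 := norm_received_sub_le hmin
  have h4 := hconv q.1 (x - x') fun n hn => by rw [Pi.sub_apply, hx n hn, hx' n hn, sub_zero]
  rw [div_lt_iff₀ (by positivity)] at h2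
  have h5 : c * ‖q.1‖ * Δ ≤ c * ‖q.1‖ * ‖x - x'‖ := by gcongr
  linarith

/-- Nested grid codes with minimum distance decoding. Each decoder gives up when the first tap is
weak, which makes the error probability two-sidedly controlled. -/
theorem exists_gridCode {N ν Mr : ℕ} (hN : 1 ≤ N) (hMr : 1 ≤ Mr) :
    ∃ c : ℝ, 0 < c ∧ ∃ c' : ℝ, 0 < c' ∧ ∀ (snr : ℝ≥0) (mH mL : ℕ), 2 ≤ mH → 2 ≤ mL →
      ∀ τ tH tL : ℝ, ∃ C : TwoStreamCode N ν Mr snr,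
      C.numH = mH ^ (2 * N) ∧ C.numL = mL ^ (2 * N) ∧
      (0 < snr → 0 < τ → 0 ≤ tH → tH ≤ 1 → 0 ≤ tL → tL ≤ 1 →
        c' * tH ^ 2 ≤ C.errH ∧ c' * tL ^ 2 ≤ C.errL ∧
        C.errH ≤ (N + ν : ℕ) * Mr * 4 * Real.exp (-τ ^ 2 / 4)
          + (4 * (2 * τ / (c * (√snr / (4 * mH)))) ^ 2) ^ (Mr * (ν + 1)) + 4 * tH ^ 2 ∧
        C.errL ≤ (N + ν : ℕ) * Mr * 4 * Real.exp (-τ ^ 2 / 4)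
          + (4 * (2 * τ / (c * (√snr / (4 * mH * mL)))) ^ 2) ^ (Mr * (ν + 1)) + 4 * tL ^ 2) := by
  obtain ⟨c, hc, hconv⟩ := exists_mul_norm_le_norm_received N ν Mr
  obtain ⟨c', hc', hball⟩ := exists_le_stdComplexGaussian_closedBall
  refine ⟨c, hc, c' / 2, by positivity, fun snr mH mL hmH hmL τ tH tL => ?_⟩
  have hmH' : (2 : ℝ) ≤ mH := by exact_mod_cast hmH
  have hmL' : (2 : ℝ) ≤ mL := by exact_mod_cast hmL
  have hN' : (1 : ℝ) ≤ N := by exact_mod_cast hN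
  have htwo : ∀ m : ℕ, 2 ≤ m → 2 ≤ m ^ (2 * N) := fun m hm =>
    hm.trans (Nat.le_self_pow (by omega) m)
  have hkH := htwo mH hmH
  have hkL := htwo mL hmL
  let eH : Fin (mH ^ (2 * N)) ≃ (Fin N → Fin 2 → Fin mH) :=
    (Fintype.equivFinOfCardEq (by simp [pow_mul])).symm
  let eL : Fin (mL ^ (2 * N)) ≃ (Fin N → Fin 2 → Fin mL) :=
    (Fintype.equivFinOfCardEq (by simp [pow_mul])).symm
  -- With `4 * w * mH * mL = √snr` every single symbol has energy at most `snr`, and the coarse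
  -- separation `w * mL` no longer involves `mL`.
  set w : ℝ := √snr / (4 * mH * mL) with hw_def
  have hw : 0 ≤ w := by positivity
  have hwL : w * mL = √snr / (4 * mH) := by rw [hw_def]; field_simp
  let x : Fin (mH ^ (2 * N)) → Fin (mL ^ (2 * N)) → Fin (N + ν) → ℂ := fun i j =>
    gridCodeword N ν w (eH i) (eL j)
  have hguard : ∀ i j (n : Fin (N + ν)), N ≤ (n : ℕ) → x i j n = 0 := fun i j n hn =>
    gridCodeword_guard w _ _ hn
  have : Nonempty (Fin (mH ^ (2 * N)) × Fin (mL ^ (2 * N))) :=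
    ⟨⟨⟨0, by omega⟩, ⟨0, by omega⟩⟩⟩
  obtain ⟨d, hd, hdmin⟩ := exists_measurable_argmin
    (f := fun (k : Fin (mH ^ (2 * N)) × Fin (mL ^ (2 * N)))
      (q : Taps ν Mr × Samples N ν Mr) => ‖q.2 - received q.1 (x k.1 k.2) 0‖)
    fun k => measurable_norm_sub_received (x k.1 k.2)
  let p₀ : Fin Mr := ⟨0, by omega⟩
  have htap : ∀ t : ℝ, MeasurableSet {q : Taps ν Mr × Samples N ν Mr | ‖q.1 0 p₀‖ ≤ t} :=
    fun t => measurableSet_le (by fun_prop) measurable_const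
  let C : TwoStreamCode N ν Mr snr :=
    { numH := mH ^ (2 * N)
      numL := mL ^ (2 * N)
      two_le_numH := hkH
      two_le_numL := hkL
      enc := x
      power_le := by
        have h2H : (2 : ℝ) ≤ (mH ^ (2 * N) : ℕ) := by exact_mod_cast hkH
        have h2L : (2 : ℝ) ≤ (mL ^ (2 * N) : ℕ) := by exact_mod_cast hkL
        rw [div_le_iff₀ (by positivity)]
        have hone : ∀ i j n, ‖x i j n‖ ^ 2 ≤ snr := fun i j n => by
          refine (sq_norm_gridCodeword_le hw _ _ n).trans (le_of_eq ?_)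
          have : 4 * w * mH * mL = √snr := by rw [hw_def]; field_simp
          rw [this, Real.sq_sqrt snr.coe_nonneg]
        calc ∑ i, ∑ j, ∑ n, ‖x i j n‖ ^ 2
            ≤ ∑ _i : Fin (mH ^ (2 * N)), ∑ _j : Fin (mL ^ (2 * N)), ∑ _n : Fin (N + ν),
                (snr : ℝ) :=
              Finset.sum_le_sum fun i _ => Finset.sum_le_sum fun j _ =>
                Finset.sum_le_sum fun n _ => hone i j n
          _ = _ := by
              simp only [Finset.sum_const, Finset.card_univ, Fintype.card_fin, nsmul_eq_mul]
              push_cast; ring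
      decH := fun h y => if ‖h 0 p₀‖ ≤ tH then ⟨0, by omega⟩ else (d (h, y)).1
      decL := fun h y => if ‖h 0 p₀‖ ≤ tL then ⟨0, by omega⟩ else (d (h, y)).2
      measurable_decH := Measurable.ite (htap tH) measurable_const (measurable_fst.comp hd)
      measurable_decL := Measurable.ite (htap tL) measurable_const (measurable_snd.comp hd) }
  refine ⟨C, rfl, rfl, fun hsnr hτ htH0 htH1 htL0 htL1 => ?_⟩
  have hsq : 0 < √(snr : ℝ) := Real.sqrt_pos.2 (by exact_mod_cast hsnr)
  have hwpos : 0 < w := by positivity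
  have htaplow : ∀ t, 0 ≤ t → t ≤ 1 → c' * t ^ 2 ≤
      (channelLaw N ν Mr).real {q | ‖q.1 0 p₀‖ ≤ t} := fun t h0 h1 => by
    rw [channelLaw_tap_norm_le, measureReal_def,
      ← ENNReal.toReal_ofReal (show 0 ≤ c' * t ^ 2 by positivity)]
    exact ENNReal.toReal_mono (measure_ne_top _ _) (hball t h0 h1)
  have htapup : ∀ t, 0 ≤ t →
      (channelLaw N ν Mr).real {q | ‖q.1 0 p₀‖ ≤ t} ≤ 4 * t ^ 2 := fun t h0 => by
    rw [channelLaw_tap_norm_le, measureReal_def,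
      ← ENNReal.toReal_ofReal (show 0 ≤ 4 * t ^ 2 by positivity)]
    exact ENNReal.toReal_mono ENNReal.ofReal_ne_top (stdComplexGaussian_closedBall_le h0)
  have hupper : ∀ (t Δ : ℝ), 0 ≤ t → 0 < Δ → ∀ E : Set (Taps ν Mr × Samples N ν Mr),
      E ⊆ badEvent N ν Mr τ (2 * τ / (c * Δ)) ∪ {q | ‖q.1 0 p₀‖ ≤ t} →
      (channelLaw N ν Mr).real E ≤ (N + ν : ℕ) * Mr * 4 * Real.exp (-τ ^ 2 / 4)
          + (4 * (2 * τ / (c * Δ)) ^ 2) ^ (Mr * (ν + 1)) + 4 * t ^ 2 := by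
    intro t Δ ht hΔ E hE
    exact (measureReal_mono hE).trans ((measureReal_union_le _ _).trans
      (add_le_add (channelLaw_badEvent_le N ν Mr hτ (by positivity)) (htapup t ht)))
  refine ⟨?_, ?_, ?_, ?_⟩
  · rw [div_mul_eq_mul_div]
    refine half_le_average hkH hkL (by positivity) ⟨0, by omega⟩
      (fun i j => measureReal_nonneg) fun i j hi => ?_
    refine (htaplow tH htH0 htH1).trans (measureReal_mono fun q hq => ?_)
    have hq' : ‖q.1 0 p₀‖ ≤ tH := hq
    change (if ‖q.1 0 p₀‖ ≤ tH then _ else _) ≠ i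
    rw [if_pos hq']
    exact hi.symm
  · rw [div_mul_eq_mul_div, TwoStreamCode.errL, Finset.sum_comm, mul_comm (C.numH : ℝ)]
    refine half_le_average hkL hkH (by positivity) ⟨0, by omega⟩
      (fun i j => measureReal_nonneg) fun i j hi => ?_
    refine (htaplow tL htL0 htL1).trans (measureReal_mono fun q hq => ?_)
    have hq' : ‖q.1 0 p₀‖ ≤ tL := hq
    change (if ‖q.1 0 p₀‖ ≤ tL then _ else _) ≠ i
    rw [if_pos hq']
    exact hi.symm
  · refine average_le hkH hkL fun i j => hupper tH _ htH0 (by positivity) _ fun q hq => ?_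
    by_cases hle : ‖q.1 0 p₀‖ ≤ tH
    · exact Or.inr hle
    · left
      have hne : (d (q.1, received q.1 (x i j) q.2)).1 ≠ i := by
        have hq' : (if ‖q.1 0 p₀‖ ≤ tH then _ else
          (d (q.1, received q.1 (x i j) q.2)).1) ≠ i := hq
        rwa [if_neg hle] at hq'
      refine mem_badEvent_of_confusion hc hconv (hguard i j) (hguard _ _) (by positivity) ?_
        (hdmin (q.1, received q.1 (x i j) q.2) (i, j))
      rw [← hwL]
      exact mul_le_norm_gridCodeword_sub hw _ _ fun h => hne (eH.injective h).symm
  · refine average_le hkH hkL fun i j => hupper tL _ htL0 (by positivity) _ fun q hq => ?_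
    by_cases hle : ‖q.1 0 p₀‖ ≤ tL
    · exact Or.inr hle
    · left
      have hne : (d (q.1, received q.1 (x i j) q.2)).2 ≠ j := by
        have hq' : (if ‖q.1 0 p₀‖ ≤ tL then _ else
          (d (q.1, received q.1 (x i j) q.2)).2) ≠ j := hq
        rwa [if_neg hle] at hq'
      refine mem_badEvent_of_confusion hc hconv (hguard i j) (hguard _ _) (by positivity) ?_
        (hdmin (q.1, received q.1 (x i j) q.2) (i, j))
      exact le_norm_gridCodeword_sub_of_ne hw (by omega) _ _ fun h => hne (eL.injective h).symm

/-! ### Exponents of the grid code and achievability -/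

theorem eventually_log_pow_mul_rpow_le {d D : ℝ} (hD : D < d) (K : ℝ) (m : ℕ) :
    ∀ᶠ s : ℝ≥0 in atTop, K * Real.log s ^ m * (s : ℝ) ^ (-d) ≤ (s : ℝ) ^ (-D) / 3 := by
  have hlo := ((isLittleO_log_rpow_rpow_atTop (m : ℝ) (sub_pos.2 hD)).const_mul_left K).comp_tendsto
    tendsto_coe_nnreal_atTop
  filter_upwards [hlo.bound (show (0 : ℝ) < 1 / 3 by norm_num), eventually_one_lt_coe_nnreal]
    with s h1 h2
  have hs0 : (0 : ℝ) < s := by linarith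
  simp only [Function.comp_apply, Real.rpow_natCast, Real.norm_eq_abs] at h1
  rw [abs_of_pos (Real.rpow_pos_of_pos hs0 _)] at h1
  have h3 := (le_abs_self _).trans h1
  calc K * Real.log s ^ m * (s : ℝ) ^ (-d)
      ≤ 1 / 3 * (s : ℝ) ^ (d - D) * (s : ℝ) ^ (-d) :=
        mul_le_mul_of_nonneg_right h3 (Real.rpow_nonneg hs0.le _)
    _ = (s : ℝ) ^ (-D) / 3 := by
        rw [mul_assoc, ← Real.rpow_add hs0, one_div_mul_eq_div]
        congr 2; ring

/-- Once `log s ≥ 4 (|D| + 1)`, the exponential is at most `s ^ (-D - 1)`, and the spare factor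
`s⁻¹` absorbs `a`. The third is the share of one of the three terms in the error bound. -/
theorem eventually_exp_neg_log_sq_le (a D : ℝ) :
    ∀ᶠ s : ℝ≥0 in atTop, a * Real.exp (-Real.log s ^ 2 / 4) ≤ (s : ℝ) ^ (-D) / 3 := by
  filter_upwards [tendsto_log_coe_nnreal_atTop.eventually_ge_atTop (4 * (|D| + 1)),
    tendsto_coe_nnreal_atTop.eventually_ge_atTop (3 * |a|), eventually_one_lt_coe_nnreal]
    with s h1 h2 h3
  have hs0 : (0 : ℝ) < s := by linarith
  have hlog : 0 < Real.log s := Real.log_pos h3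
  have hexp : Real.exp (-Real.log s ^ 2 / 4) ≤ (s : ℝ) ^ (-D) * (s : ℝ)⁻¹ := by
    rw [← Real.rpow_neg_one, ← Real.rpow_add hs0, Real.rpow_def_of_pos hs0]
    refine Real.exp_le_exp.2 ?_
    nlinarith [le_abs_self D]
  have ha : |a| * (s : ℝ)⁻¹ ≤ 1 / 3 := by
    rw [← div_eq_mul_inv, div_le_iff₀ hs0]; linarith
  calc a * Real.exp (-Real.log s ^ 2 / 4)
      ≤ |a| * ((s : ℝ) ^ (-D) * (s : ℝ)⁻¹) :=
        mul_le_mul (le_abs_self a) hexp (Real.exp_nonneg _) (abs_nonneg a)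
    _ = (|a| * (s : ℝ)⁻¹) * (s : ℝ) ^ (-D) := by ring
    _ ≤ 1 / 3 * (s : ℝ) ^ (-D) :=
        mul_le_mul_of_nonneg_right ha (Real.rpow_nonneg hs0.le _)
    _ = _ := by ring

/-- The error bound of the grid code with `m` levels per real dimension decays with the exponent
`k (1 - ρ)` when `m` grows like `s ^ (ρ / 2)`. -/
theorem eventually_gridCode_bound_le {a c B ρ D : ℝ} (hc : 0 < c) {k : ℕ} {m : ℝ≥0 → ℝ}
    (hm0 : ∀ s, 0 < m s) (hm : ∀ᶠ s : ℝ≥0 in atTop, m s ≤ B * (s : ℝ) ^ (ρ / 2))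
    (hD : D < k * (1 - ρ)) :
    ∀ᶠ s : ℝ≥0 in atTop,
      a * Real.exp (-Real.log s ^ 2 / 4)
        + (4 * (2 * Real.log s / (c * (√s / (4 * m s)))) ^ 2) ^ k
        + 4 * ((s : ℝ) ^ (-(k * (1 - ρ)) / 2)) ^ 2 ≤ (s : ℝ) ^ (-D) := by
  filter_upwards [eventually_exp_neg_log_sq_le a D,
    eventually_log_pow_mul_rpow_le hD ((256 * B ^ 2 / c ^ 2) ^ k) (2 * k),
    eventually_log_pow_mul_rpow_le hD 4 0, hm, eventually_one_lt_coe_nnreal]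
    with s h1 h2 h3 h4 h5
  have hs0 : (0 : ℝ) < s := by linarith
  have hms := hm0 s
  have hlog : 0 < Real.log s := Real.log_pos h5
  have hsq : 0 < √(s : ℝ) := Real.sqrt_pos.2 hs0
  have hterm : 4 * (2 * Real.log s / (c * (√s / (4 * m s)))) ^ 2
      ≤ 256 * B ^ 2 / c ^ 2 * Real.log s ^ 2 * (s : ℝ) ^ (-(1 - ρ)) := by
    have e1 : 4 * (2 * Real.log s / (c * (√s / (4 * m s)))) ^ 2
        = 256 * Real.log s ^ 2 / c ^ 2 * ((m s) ^ 2 / (s : ℝ)) := by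
      have : 2 * Real.log s / (c * (√s / (4 * m s))) = 8 * Real.log s * m s / (c * √s) := by
        field_simp; norm_num
      rw [this, div_pow, mul_pow, mul_pow, mul_pow, Real.sq_sqrt hs0.le]
      field_simp; norm_num
    have e2 : (B * (s : ℝ) ^ (ρ / 2)) ^ 2 / (s : ℝ) = B ^ 2 * (s : ℝ) ^ (-(1 - ρ)) := by
      rw [mul_pow, ← Real.rpow_natCast ((s : ℝ) ^ (ρ / 2)), ← Real.rpow_mul hs0.le, mul_div_assoc]
      nth_rewrite 2 [← Real.rpow_one (s : ℝ)]
      rw [← Real.rpow_sub hs0]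
      congr 2; push_cast; ring
    have e3 : (m s) ^ 2 / (s : ℝ) ≤ B ^ 2 * (s : ℝ) ^ (-(1 - ρ)) := by
      rw [← e2]
      exact div_le_div_of_nonneg_right (pow_le_pow_left₀ hms.le h4 2) hs0.le
    rw [e1]
    calc _ ≤ 256 * Real.log s ^ 2 / c ^ 2 * (B ^ 2 * (s : ℝ) ^ (-(1 - ρ))) :=
          mul_le_mul_of_nonneg_left e3 (by positivity)
      _ = _ := by ring
  have hpow : (4 * (2 * Real.log s / (c * (√s / (4 * m s)))) ^ 2) ^ k
      ≤ (256 * B ^ 2 / c ^ 2) ^ k * Real.log s ^ (2 * k) * (s : ℝ) ^ (-(k * (1 - ρ))) := by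
    refine (pow_le_pow_left₀ (by positivity) hterm k).trans (le_of_eq ?_)
    rw [mul_pow, mul_pow, ← pow_mul, ← Real.rpow_natCast ((s : ℝ) ^ (-(1 - ρ))),
      ← Real.rpow_mul hs0.le]
    congr 2; ring
  have hlast : ((s : ℝ) ^ (-(k * (1 - ρ)) / 2)) ^ 2 = (s : ℝ) ^ (-(k * (1 - ρ))) := by
    rw [← Real.rpow_natCast, ← Real.rpow_mul hs0.le]
    congr 1; push_cast; ring
  rw [pow_zero, mul_one] at h3
  rw [hlast]
  linarith

/-- Matching polynomial bounds determine the diversity order. -/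
theorem tendsto_neg_log_div_log {err : ℝ≥0 → ℝ} {c d : ℝ} (hc : 0 < c)
    (hlow : ∀ᶠ s : ℝ≥0 in atTop, c * (s : ℝ) ^ (-d) ≤ err s)
    (hup : ∀ D < d, ∀ᶠ s : ℝ≥0 in atTop, err s ≤ (s : ℝ) ^ (-D)) :
    Tendsto (fun s : ℝ≥0 => -Real.log (err s) / Real.log s) atTop (nhds d) := by
  refine tendsto_order.2 ⟨fun D hD => ?_, fun D hD => ?_⟩
  · obtain ⟨D', hD1, hD2⟩ := exists_between hD
    filter_upwards [hlow, hup D' hD2, eventually_one_lt_coe_nnreal] with s h1 h2 h3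
    have hs0 : (0 : ℝ) < s := by linarith
    have hlog := Real.log_pos h3
    have herr : 0 < err s := (mul_pos hc (Real.rpow_pos_of_pos hs0 _)).trans_le h1
    have := Real.log_le_log herr h2
    rw [Real.log_rpow hs0] at this
    rw [lt_div_iff₀ hlog]
    nlinarith
  · filter_upwards [hlow, eventually_one_lt_coe_nnreal,
      tendsto_log_coe_nnreal_atTop.eventually_gt_atTop (-Real.log c / (D - d))] with s h1 h3 h4
    have hs0 : (0 : ℝ) < s := by linarith
    have hlog := Real.log_pos h3
    have hpos := Real.rpow_pos_of_pos hs0 (-d)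
    have := Real.log_le_log (mul_pos hc hpos) h1
    rw [Real.log_mul hc.ne' hpos.ne', Real.log_rpow hs0] at this
    rw [div_lt_iff₀ (by linarith)] at h4
    rw [div_lt_iff₀ hlog]
    nlinarith

/-- Number of grid levels per real dimension. -/
noncomputable def gridLevels (ρ : ℝ) (s : ℝ≥0) : ℕ := ⌈(s : ℝ) ^ (ρ / 2)⌉₊ + 2

theorem two_le_gridLevels (ρ : ℝ) (s : ℝ≥0) : 2 ≤ gridLevels ρ s := by
  unfold gridLevels; omega

theorem gridLevels_pos (ρ : ℝ) (s : ℝ≥0) : (0 : ℝ) < gridLevels ρ s := by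
  have := two_le_gridLevels ρ s
  exact_mod_cast (by omega : 0 < gridLevels ρ s)

theorem rpow_le_gridLevels (ρ : ℝ) (s : ℝ≥0) : (s : ℝ) ^ (ρ / 2) ≤ gridLevels ρ s := by
  unfold gridLevels
  push_cast
  linarith [Nat.le_ceil ((s : ℝ) ^ (ρ / 2))]

theorem gridLevels_le {ρ : ℝ} (hρ : 0 ≤ ρ) {s : ℝ≥0} (hs : (1 : ℝ) < s) :
    (gridLevels ρ s : ℝ) ≤ 4 * (s : ℝ) ^ (ρ / 2) := by
  have h1 : (1 : ℝ) ≤ (s : ℝ) ^ (ρ / 2) := Real.one_le_rpow hs.le (by linarith)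
  unfold gridLevels
  push_cast
  linarith [Nat.ceil_lt_add_one (a := (s : ℝ) ^ (ρ / 2)) (by linarith)]

theorem tendsto_log_gridLevels {ρ : ℝ} (hρ : 0 ≤ ρ) :
    Tendsto (fun s : ℝ≥0 => Real.log (gridLevels ρ s) / Real.log s) atTop (nhds (ρ / 2)) := by
  have hup : Tendsto (fun s : ℝ≥0 => ρ / 2 + Real.log 4 / Real.log s) atTop
      (nhds (ρ / 2 + 0)) :=
    tendsto_const_nhds.add (tendsto_log_coe_nnreal_atTop.const_div_atTop _)
  rw [add_zero] at hup
  refine tendsto_of_tendsto_of_tendsto_of_le_of_le' tendsto_const_nhds hup ?_ ?_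
  · filter_upwards [eventually_one_lt_coe_nnreal] with s hs
    have hs0 : (0 : ℝ) < s := by linarith
    have := Real.log_le_log (Real.rpow_pos_of_pos hs0 _) (rpow_le_gridLevels ρ s)
    rw [Real.log_rpow hs0] at this
    rwa [le_div_iff₀ (Real.log_pos hs)]
  · filter_upwards [eventually_one_lt_coe_nnreal] with s hs
    have hs0 : (0 : ℝ) < s := by linarith
    have hpos := Real.rpow_pos_of_pos hs0 (ρ / 2)
    have := Real.log_le_log (gridLevels_pos ρ s) (gridLevels_le hρ hs)
    rw [Real.log_mul (by norm_num) hpos.ne', Real.log_rpow hs0] at this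
    have hlog := Real.log_pos hs
    rw [div_le_iff₀ hlog, add_mul, div_mul_cancel₀ _ hlog.ne']
    linarith

/-- Only `2N` real dimensions carry data during `N + ν` channel uses; the factor `(N + ν) / N`
compensates for the guard interval. -/
theorem tendsto_rate_gridLevels {N ν : ℕ} (hN : 1 ≤ N) {r : ℝ} (hr : 0 ≤ r) :
    Tendsto (fun s : ℝ≥0 =>
      Real.log ((gridLevels (((N : ℝ) + ν) / N * r) s ^ (2 * N) : ℕ) : ℝ) / ((N : ℝ) + ν)
        / Real.log s) atTop (nhds r) := by
  have hN' : (1 : ℝ) ≤ N := by exact_mod_cast hN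
  have h := (tendsto_log_gridLevels (ρ := ((N : ℝ) + ν) / N * r) (by positivity)).const_mul
    (2 * N / ((N : ℝ) + ν))
  have hlim : 2 * N / ((N : ℝ) + ν) * (((N : ℝ) + ν) / N * r / 2) = r := by
    have : (N : ℝ) + ν ≠ 0 := by positivity
    field_simp
  rw [hlim] at h
  refine h.congr fun s => ?_
  rw [Nat.cast_pow, Real.log_pow]
  push_cast
  ring

/-- Achievability: nested grid codes with a guard interval. -/
theorem achievable_gridCode {N ν Mr : ℕ} (hN : 1 ≤ N) (hMr : 1 ≤ Mr) {rH rL : ℝ}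
    (hrH : 0 ≤ rH) (hrL : 0 ≤ rL) (hr : rH + rL ≤ (N : ℝ) / ((N : ℝ) + ν)) :
    Achievable N ν Mr rH ((Mr : ℝ) * ((ν : ℝ) + 1) * (1 - ((N : ℝ) + ν) / N * rH))
      rL ((Mr : ℝ) * ((ν : ℝ) + 1) * (1 - ((N : ℝ) + ν) / N * (rH + rL))) := by
  have hN' : (1 : ℝ) ≤ N := by exact_mod_cast hN
  set ρH : ℝ := ((N : ℝ) + ν) / N * rH with hρH
  set ρL : ℝ := ((N : ℝ) + ν) / N * rL with hρL
  have hρH0 : 0 ≤ ρH := by positivity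
  have hρL0 : 0 ≤ ρL := by positivity
  have hadd : ((N : ℝ) + ν) / N * (rH + rL) = ρH + ρL := by rw [mul_add]
  have hle : ρH + ρL ≤ 1 := by
    rw [← hadd]
    rw [le_div_iff₀ (by positivity)] at hr
    rw [div_mul_eq_mul_div, div_le_one (by positivity)]
    linarith
  rw [hadd]
  set k : ℕ := Mr * (ν + 1) with hk
  have hkc : (Mr : ℝ) * ((ν : ℝ) + 1) = k := by rw [hk]; push_cast; ring
  rw [hkc]
  have hdH : 0 ≤ (k : ℝ) * (1 - ρH) := mul_nonneg (by positivity) (by linarith)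
  have hdL : 0 ≤ (k : ℝ) * (1 - (ρH + ρL)) := mul_nonneg (by positivity) (by linarith)
  obtain ⟨c, hc, c', hc', hcode⟩ := exists_gridCode (ν := ν) hN hMr
  -- The noise threshold `log s` costs only logarithmic factors in the weak-tap term. The squares of
  -- the two give-up thresholds are `s` to the minus target diversity orders, so deliberate failures
  -- match the exponents claimed.
  choose C hCH hCL hC using fun s : ℝ≥0 => hcode s (gridLevels ρH s) (gridLevels ρL s)
    (two_le_gridLevels _ _) (two_le_gridLevels _ _) (Real.log s)
    ((s : ℝ) ^ (-((k : ℝ) * (1 - ρH)) / 2)) ((s : ℝ) ^ (-((k : ℝ) * (1 - (ρH + ρL))) / 2))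
  have hbounds : ∀ s : ℝ≥0, (1 : ℝ) < s → _ := fun s hs =>
    have hs0 : (0 : ℝ) < s := by linarith
    hC s (by exact_mod_cast hs0) (Real.log_pos hs) (Real.rpow_nonneg hs0.le _)
      (Real.rpow_le_one_of_one_le_of_nonpos hs.le (by linarith)) (Real.rpow_nonneg hs0.le _)
      (Real.rpow_le_one_of_one_le_of_nonpos hs.le (by linarith))
  have hsq : ∀ (s : ℝ≥0) (d : ℝ), (1 : ℝ) < s →
      ((s : ℝ) ^ (-d / 2)) ^ 2 = (s : ℝ) ^ (-d) := fun s d hs => by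
    rw [← Real.rpow_natCast, ← Real.rpow_mul (by linarith)]
    congr 1; push_cast; ring
  refine ⟨?_, C, ?_, ?_, ?_, ?_⟩
  · exact mul_le_mul_of_nonneg_left (by linarith) (by positivity)
  · refine (tendsto_rate_gridLevels (ν := ν) hN hrH).congr fun s => ?_
    rw [TwoStreamCode.rateH, hCH]
  · refine (tendsto_rate_gridLevels (ν := ν) hN hrL).congr fun s => ?_
    rw [TwoStreamCode.rateL, hCL]
  · refine tendsto_neg_log_div_log hc' ?_ fun D hD => ?_
    · filter_upwards [eventually_one_lt_coe_nnreal] with s hs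
      rw [← hsq s _ hs]
      exact (hbounds s hs).1
    · filter_upwards [eventually_one_lt_coe_nnreal,
        eventually_gridCode_bound_le (a := (N + ν : ℕ) * Mr * 4) hc (gridLevels_pos ρH)
          (eventually_one_lt_coe_nnreal.mono fun s hs => gridLevels_le hρH0 hs) hD] with s hs hb
      exact (hbounds s hs).2.2.1.trans hb
  · refine tendsto_neg_log_div_log hc' ?_ fun D hD => ?_
    · filter_upwards [eventually_one_lt_coe_nnreal] with s hs
      rw [← hsq s _ hs]
      exact (hbounds s hs).2.1
    · have hm : ∀ᶠ s : ℝ≥0 in atTop, (gridLevels ρH s : ℝ) * gridLevels ρL s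
          ≤ 16 * (s : ℝ) ^ ((ρH + ρL) / 2) := by
        filter_upwards [eventually_one_lt_coe_nnreal] with s hs
        have hs0 : (0 : ℝ) < s := by linarith
        refine (mul_le_mul (gridLevels_le hρH0 hs) (gridLevels_le hρL0 hs)
          (Nat.cast_nonneg _) (by positivity)).trans (le_of_eq ?_)
        rw [add_div, Real.rpow_add hs0]
        ring
      filter_upwards [eventually_one_lt_coe_nnreal,
        eventually_gridCode_bound_le (a := (N + ν : ℕ) * Mr * 4) hc
          (fun s => mul_pos (gridLevels_pos ρH s) (gridLevels_pos ρL s)) hm hD] with s hs hb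
      refine (hbounds s hs).2.2.2.trans ?_
      rw [mul_assoc 4 (gridLevels ρH s : ℝ)]
      exact hb

end SimoIsi

theorem theorem4 (N ν Mr : ℕ) (hN : 1 ≤ N) (hMr : 1 ≤ Mr) (rH rL : ℝ)
    (hrH : 0 ≤ rH) (hrL : 0 ≤ rL) (hr : rH + rL ≤ (N : ℝ) / ((N : ℝ) + ν)) :
    (∃ dH dL : ℝ, SimoIsi.Achievable N ν Mr rH dH rL dL ∧
      (Mr : ℝ) * ((ν : ℝ) + 1) * (1 - ((N : ℝ) + ν) / N * rH) ≤ dH ∧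
      (Mr : ℝ) * ((ν : ℝ) + 1) * (1 - ((N : ℝ) + ν) / N * (rH + rL)) ≤ dL) ∧
    (∀ dH dL : ℝ, SimoIsi.Achievable N ν Mr rH dH rL dL →
      dH ≤ (Mr : ℝ) * ((ν : ℝ) + 1) * (1 - rH) ∧
      dL ≤ (Mr : ℝ) * ((ν : ℝ) + 1) * (1 - (rH + rL))) := by
  refine ⟨⟨_, _, SimoIsi.achievable_gridCode hN hMr hrH hrL hr, le_rfl, le_rfl⟩,
    fun dH dL h => h.le_outage hN hMr hrL ?_⟩
  have hN' : (1 : ℝ) ≤ N := by exact_mod_cast hN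
  exact hr.trans ((div_le_one (by positivity)).2 (by linarith [Nat.cast_nonneg (α := ℝ) ν]))
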